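/- Let $(\mathcal A,\otimes,k)$ be a bicomplete abelian category with a closed symmetric monoidal structure, and let $\mathcal P$ be a reduced symmetric operad in $\mathcal A$ ($\mathcal P_0=0$ and the unit $k\to\mathcal P_1$ is an isomorphism). For objects $B,X$ of $\mathcal A$ put $$\mathcal P\circ(B|X)=\bigoplus_{n}\mathcal P_n\otimes_{\Sigma_n}\bigl((X\oplus B)^{\otimes n}/B^{\otimes n}\bigr),$$ which is the complement of $\mathcal P(B)$ in the value $\mathcal P(X\oplus B)$ of the Schur functor. * An *action* of a $\mathcal P$-algebra $B$ on a $\mathcal P$-algebra $X$ is a morphism $\rho:\mathcal P\circ(B|X)\to X$ of $\mathcal A$ whose restriction along $\mathcal P(X)\to\mathcal P\circ(B|X)$ is the structure map of $X$ and which is associative, that is, the two morphisms $\mathcal P\circ(\mathcal P(B)\,|\,\mathcal P\circ(B|X))\to X$ given by $\rho$ after the operadic composition, and by $\rho$ after applying $\rho$ and the structure map of $B$ inside, coincide. Every $B$ acts on itself by $\mathcal P\circ(B|B)\hookrightarrow\mathcal P(B\oplus B)\to\mathcal P(B)\to B$. * A *precrossed module* is an action $\rho$ of $B$ on $X$ together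 with a morphism of $\mathcal P$-algebras $d:X\to B$ which is equivariant, i.e. such that $(\mathrm{id}_B,d)$ carries $\rho$ to the action of $B$ on itself. A morphism $(\rho,d)\to(\rho',d')$ is a pair of algebra morphisms $g:B\to B'$, $f:X\to X'$ with $f\circ\rho=\rho'\circ\mathcal P\circ(g|f)$ and $g d=d' f$. * A *crossed module* is a precrossed module which satisfies the Peiffer identity: for all $n\ge i\ge 2$ the morphism $\mathcal P_n\otimes X^{\otimes i}\otimes B^{\otimes (n-i)}\to\mathcal P\circ(B|X)\xrightarrow{\rho}X$ equals the composite of $\mathrm{id}\otimes \mathrm{id}_X\otimes d^{\otimes(i-1)}\otimes\mathrm{id}$ with $\mathcal P_n\otimes X\otimes B^{\otimes (n-1)}\to\mathcal P\circ(B|X)\xrightarrow{\rho}X$; in terms of elements, $$\rho(\gamma;x_1,\dots,x_i,b_{i+1},\dots,b_n)=\rho(\gamma;x_1,dx_2,\dots,dx_i,b_{i+1},\dots,b_n).$$ * A *reflexive graph* of $\mathcal P$-algebras consists of algebra morphisms $s,t:E\to B$ and $i:B\to E$ with $si=ti=\mathrm{id}_B$; morphisms are morphisms of diagrams. It is a *$\mathrm{Cat}^1$-$\mathcal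 P$-algebra* if for every $n\ge2$ the structure map of $E$ vanishes on $\mathcal P_n\otimes\ker(s)\otimes\ker(t)\otimes E^{\otimes (n-2)}$. Let $\mathrm{XMod}(\mathcal P\text{-alg})$ and $\mathrm{Cat}^1(\mathcal P\text{-alg})$ be the full subcategories of the categories of precrossed modules and of reflexive graphs spanned by the crossed modules and by the $\mathrm{Cat}^1$-$\mathcal P$-algebras. The functor which sends a precrossed module $(\rho,d:X\to B)$ to the reflexive graph $$0\oplus\mathrm{id},\ d\oplus\mathrm{id}:\ X\oplus B\rightrightarrows B,\qquad i_2:B\to X\oplus B$$ (where $X\oplus B$ has the algebra structure given by $\rho$ on $\mathcal P\circ(B|X)$ and by the structure map of $B$ on $\mathcal P(B)$), and a morphism $(g,f)$ to $(f\oplus g,g)$, is an equivalence from precrossed modules to reflexive graphs. A precrossed module is crossed if and only if its reflexive graph is a $\mathrm{Cat}^1$-$\mathcal P$-algebra, and the equivalence restricts to an equivalence of categories $$\mathrm{XMod}(\mathcal P\text{-alg})\simeq\mathrm{Cat}^1(\mathcal P\text{-alg}).$$ -/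

import Mathlib

open CategoryTheory CategoryTheory.Limits MonoidalCategory

set_option linter.unusedSectionVars false

universe v u

noncomputable section

namespace OperadCrossed

section TensorPowers

variable {A : Type u} [Category.{v} A] [MonoidalCategory A]

/-- The tensor power `Y ⊗ ... ⊗ Y` with `n` factors, bracketed to the left. -/
@[reducible] def tpow (Y : A) : ℕ → A
  | 0 => 𝟙_ A
  | n + 1 => tpow Y n ⊗ Y

/-- The tensor power of a morphism. -/
def tpowMap {Y Z : A} (f : Y ⟶ Z) : ∀ n, tpow Y n ⟶ tpow Z n
  | 0 => 𝟙 _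
  | n + 1 => tpowMap f n ⊗ₘ f

/-- Concatenation of tensor powers. -/
def tpowJoin (Y : A) (m : ℕ) : ∀ n, tpow Y m ⊗ tpow Y n ≅ tpow Y (m + n)
  | 0 => ρ_ (tpow Y m)
  | n + 1 => (α_ (tpow Y m) (tpow Y n) Y).symm ≪≫ whiskerRightIso (tpowJoin Y m n) Y

/-- Concatenation of three tensor powers. -/
def tpowJoinThree (Y : A) (a n b : ℕ) :
    (tpow Y a ⊗ tpow Y n) ⊗ tpow Y b ≅ tpow Y (a + n + b) :=
  whiskerRightIso (tpowJoin Y a n) (tpow Y b) ≪≫ tpowJoin Y (a + n) b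

/-- Adding one tensor factor in front. -/
def tpowCons (Y : A) (n : ℕ) : Y ⊗ tpow Y n ≅ tpow Y (1 + n) :=
  whiskerRightIso (λ_ Y).symm (tpow Y n) ≪≫ tpowJoin Y 1 n

variable [SymmetricCategory A]

/-- `y₀ ⊗ ... ⊗ yₙ₋₁ ⊗ y` is sent to the tensor in which `y` is moved to position `i`. -/
def tpowInsert (Y : A) : ∀ n, Fin (n + 1) → (tpow Y n ⊗ Y ⟶ tpow Y (n + 1))
  | 0, _ => 𝟙 _
  | n + 1, i =>
      Fin.lastCases (motive := fun _ => (tpow Y n ⊗ Y) ⊗ Y ⟶ tpow Y (n + 2))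
        (𝟙 _)
        (fun j => ((α_ (tpow Y n) Y Y).hom ≫ tpow Y n ◁ (β_ Y Y).hom ≫
          (α_ (tpow Y n) Y Y).inv) ≫ tpowInsert Y n j ▷ Y) i

/-- The permutation induced by `σ` after deleting the last element and its image. -/
def permDeleteLast {n : ℕ} (σ : Equiv.Perm (Fin (n + 1))) : Equiv.Perm (Fin n) :=
  ((finSuccAboveEquiv (Fin.last n)).trans
    (σ.subtypeEquiv (p := fun x => x ≠ Fin.last n) (q := fun x => x ≠ σ (Fin.last n))
      (fun x => by simp))).trans
    (finSuccAboveEquiv (σ (Fin.last n))).symm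

/-- The action of the symmetric group on tensor powers: the factor in position `j` is
moved to position `σ j`. -/
def tpowPerm (Y : A) : ∀ {n : ℕ}, Equiv.Perm (Fin n) → (tpow Y n ⟶ tpow Y n)
  | 0, _ => 𝟙 _
  | n + 1, σ => tpowPerm Y (permDeleteLast σ) ▷ Y ≫ tpowInsert Y n (σ (Fin.last n))

theorem tpowMap_id (Y : A) : ∀ n, tpowMap (𝟙 Y) n = 𝟙 (tpow Y n)
  | 0 => rfl
  | n + 1 => by simp [tpowMap, tpow, tpowMap_id Y n]

theorem tpowMap_comp {X Y Z : A} (f : X ⟶ Y) (g : Y ⟶ Z) :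
    ∀ n, tpowMap (f ≫ g) n = tpowMap f n ≫ tpowMap g n
  | 0 => by simp [tpowMap]
  | n + 1 => by simp [tpowMap, tpowMap_comp f g n]

theorem tpowInsert_naturality {Y Z : A} (f : Y ⟶ Z) : ∀ n (i : Fin (n + 1)),
    tpowInsert Y n i ≫ tpowMap f (n + 1) = (tpowMap f n ⊗ₘ f) ≫ tpowInsert Z n i
  | 0, _ => by
      simp only [tpowInsert, tpowMap]
      exact (Category.id_comp _).trans (Category.comp_id _).symm
  | n + 1, i => by
      induction i using Fin.lastCases with
      | last =>
        simp only [tpowInsert, Fin.lastCases_last]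
        exact (Category.id_comp _).trans (Category.comp_id _).symm
      | cast j =>
        have ih := tpowInsert_naturality f n j
        simp only [tpowInsert, Fin.lastCases_castSucc, Category.assoc]
        have e1 : tpowMap f (n + 1 + 1) = tpowMap f (n + 1) ⊗ₘ f := rfl
        have e2 : tpowMap f (n + 1) = tpowMap f n ⊗ₘ f := rfl
        rw [e1]
        have h1 : tpowInsert Y n j ▷ Y ≫ (tpowMap f (n + 1) ⊗ₘ f) =
            ((tpowMap f n ⊗ₘ f) ⊗ₘ f) ≫ tpowInsert Z n j ▷ Z := by
          rw [← tensorHom_id, ← tensorHom_id, tensorHom_comp_tensorHom,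
            tensorHom_comp_tensorHom, ih, Category.id_comp, Category.comp_id]
        rw [h1, e2]
        simp only [← Category.assoc]
        congr 1
        simp only [Category.assoc]
        rw [← associator_inv_naturality, associator_naturality_assoc]
        congr 1
        simp only [← Category.assoc]
        congr 1
        rw [← id_tensorHom, ← id_tensorHom, tensorHom_comp_tensorHom,
          tensorHom_comp_tensorHom, Category.id_comp, Category.comp_id,
          BraidedCategory.braiding_naturality]

theorem tpowPerm_naturality {Y Z : A} (f : Y ⟶ Z) : ∀ {n} (σ : Equiv.Perm (Fin n)),
    tpowPerm Y σ ≫ tpowMap f n = tpowMap f n ≫ tpowPerm Z σ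
  | 0, _ => by simp [tpowPerm, tpowMap]
  | n + 1, σ => by
      have ih := tpowPerm_naturality f (permDeleteLast σ)
      simp only [tpowPerm, Category.assoc]
      rw [tpowInsert_naturality]
      have e2 : tpowMap f (n + 1) = tpowMap f n ⊗ₘ f := rfl
      rw [e2, ← Category.assoc, ← Category.assoc]
      congr 1
      rw [← tensorHom_id, ← tensorHom_id, tensorHom_comp_tensorHom,
        tensorHom_comp_tensorHom, ih, Category.id_comp, Category.comp_id]

theorem tpowJoin_naturality {Y Z : A} (f : Y ⟶ Z) (m : ℕ) : ∀ n,
    (tpowJoin Y m n).hom ≫ tpowMap f (m + n) =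
      (tpowMap f m ⊗ₘ tpowMap f n) ≫ (tpowJoin Z m n).hom
  | 0 => by
      have e : tpowMap f 0 = 𝟙 (𝟙_ A) := rfl
      rw [e, tensorHom_id]
      exact (rightUnitor_naturality (tpowMap f m)).symm
  | n + 1 => by
      have ih := tpowJoin_naturality f m n
      have e1 : tpowMap f (m + (n + 1)) = tpowMap f (m + n) ⊗ₘ f := rfl
      have e2 : tpowMap f (n + 1) = tpowMap f n ⊗ₘ f := rfl
      rw [e1, e2]
      simp only [tpowJoin, Iso.trans_hom, Iso.symm_hom, whiskerRightIso_hom, Category.assoc]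
      rw [associator_inv_naturality_assoc]
      congr 1
      rw [← tensorHom_id, ← tensorHom_id, tensorHom_comp_tensorHom,
        tensorHom_comp_tensorHom, ih, Category.id_comp, Category.comp_id]

theorem tpowJoinThree_naturality {Y Z : A} (f : Y ⟶ Z) (a n b : ℕ) :
    (tpowJoinThree Y a n b).hom ≫ tpowMap f (a + n + b) =
      ((tpowMap f a ⊗ₘ tpowMap f n) ⊗ₘ tpowMap f b) ≫ (tpowJoinThree Z a n b).hom := by
  simp only [tpowJoinThree, Iso.trans_hom, whiskerRightIso_hom, Category.assoc]
  rw [tpowJoin_naturality, ← Category.assoc, ← Category.assoc]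
  congr 1
  rw [← tensorHom_id, ← tensorHom_id, tensorHom_comp_tensorHom, tensorHom_comp_tensorHom,
    tpowJoin_naturality, Category.id_comp, Category.comp_id]

end TensorPowers

section Operads

/-- The positions `0, ..., a + n + b - 1`, split into the `a` first and `b` last ones on
the one hand, and the block of `n` in the middle on the other hand. -/
def blockSplit (a n b : ℕ) : Fin (a + n + b) ≃ (Fin a ⊕ Fin b) ⊕ Fin n :=
  ((finSumFinEquiv.symm.trans (Equiv.sumCongr finSumFinEquiv.symm (Equiv.refl _))).trans
    (Equiv.sumAssoc _ _ _)).trans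
    (((Equiv.refl _).sumCongr (Equiv.sumComm _ _)).trans (Equiv.sumAssoc _ _ _).symm)

/-- The bijection that applies `σ` to the middle block and `θ` to the other positions. -/
def blockEquiv {a b a' b' n n' : ℕ} (θ : Fin a ⊕ Fin b ≃ Fin a' ⊕ Fin b')
    (σ : Fin n ≃ Fin n') : Fin (a + n + b) ≃ Fin (a' + n' + b') :=
  ((blockSplit a n b).trans (Equiv.sumCongr θ σ)).trans (blockSplit a' n' b').symm

variable (A : Type u) [Category.{v} A] [MonoidalCategory A] [SymmetricCategory A]

/-- A (unital) symmetric operad in `A`, presented by partial compositions.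

The symmetric sequence is a functor from the groupoid of the finite sets `Fin n` and their
bijections; the right action of `σ` on `obj n` is `map σ⁻¹`. The morphism `comp a b n`
is the partial composition which plugs an `n`-ary operation into the input number `a` (counted
from `0`) of an operation with `a + 1 + b` inputs. -/
structure SymmOperad where
  obj : ℕ → A
  map : ∀ {m n : ℕ}, (Fin m ≃ Fin n) → (obj m ⟶ obj n)
  map_refl : ∀ n, map (Equiv.refl (Fin n)) = 𝟙 (obj n)
  map_trans : ∀ {l m n : ℕ} (e : Fin l ≃ Fin m) (f : Fin m ≃ Fin n),
    map (e.trans f) = map e ≫ map f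
  unit : 𝟙_ A ⟶ obj 1
  comp : ∀ a b n : ℕ, obj (a + 1 + b) ⊗ obj n ⟶ obj (a + n + b)
  /-- Equivariance of the partial compositions in both arguments. -/
  comp_equivariant : ∀ {a b a' b' n n' : ℕ} (θ : Fin a ⊕ Fin b ≃ Fin a' ⊕ Fin b')
    (σ : Fin n ≃ Fin n'),
    (map (blockEquiv θ (Equiv.refl (Fin 1))) ⊗ₘ map σ) ≫ comp a' b' n' =
      comp a b n ≫ map (blockEquiv θ σ)
  /-- `p ∘ id = p`. -/
  comp_unit : ∀ a b : ℕ,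
    obj (a + 1 + b) ◁ unit ≫ comp a b 1 = (ρ_ (obj (a + 1 + b))).hom
  /-- `id ∘ p = p`. -/
  unit_comp : ∀ n : ℕ,
    (unit ≫ map (finCongr (by omega : 1 = 0 + 1 + 0))) ▷ obj n ≫ comp 0 0 n =
      (λ_ (obj n)).hom ≫ map (finCongr (by omega : n = 0 + n + 0))
  /-- Sequential composition: `(p ∘ q) ∘ r = p ∘ (q ∘ r)`, where `r` is plugged into `q`. -/
  comp_sequential : ∀ a b c d n : ℕ,
    comp a b (c + 1 + d) ▷ obj n ≫
        map (finCongr (by omega : a + (c + 1 + d) + b = (a + c) + 1 + (d + b))) ▷ obj n ≫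
        comp (a + c) (d + b) n ≫
        map (finCongr (by omega : (a + c) + n + (d + b) = a + (c + n + d) + b)) =
      (α_ (obj (a + 1 + b)) (obj (c + 1 + d)) (obj n)).hom ≫
        obj (a + 1 + b) ◁ comp c d n ≫ comp a b (c + n + d)
  /-- Parallel composition: plugging `q` and `r` into two different inputs of `p` can be done in
  either order. -/
  comp_parallel : ∀ a b c m n : ℕ,
    comp a (b + 1 + c) m ▷ obj n ≫
        map (finCongr (by omega : a + m + (b + 1 + c) = (a + m + b) + 1 + c)) ▷ obj n ≫
        comp (a + m + b) c n =
      (α_ (obj (a + 1 + (b + 1 + c))) (obj m) (obj n)).hom ≫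
        obj (a + 1 + (b + 1 + c)) ◁ (β_ (obj m) (obj n)).hom ≫
        (α_ (obj (a + 1 + (b + 1 + c))) (obj n) (obj m)).inv ≫
        (map (finCongr (by omega : a + 1 + (b + 1 + c) = (a + 1 + b) + 1 + c)) ▷ obj n ≫
          comp (a + 1 + b) c n ≫
          map (finCongr (by omega : (a + 1 + b) + n + c = a + 1 + (b + n + c)))) ▷ obj m ≫
        comp a (b + n + c) m ≫
        map (finCongr (by omega : a + m + (b + n + c) = (a + m + b) + n + c))

variable {A}

/-- An operad is reduced if `P₀ = 0` and `P₁` is the unit of the tensor product. -/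
structure SymmOperad.IsReduced [HasZeroMorphisms A] (P : SymmOperad A) : Prop where
  isZero_obj_zero : IsZero (P.obj 0)
  isIso_unit : IsIso P.unit

variable (P : SymmOperad A)

/-- Moving `Q` past `U`. -/
def shuffle (R Q U V W : A) : (R ⊗ Q) ⊗ ((U ⊗ V) ⊗ W) ⟶ R ⊗ ((U ⊗ (Q ⊗ V)) ⊗ W) :=
  (α_ R Q ((U ⊗ V) ⊗ W)).hom ≫
    R ◁ ((α_ Q (U ⊗ V) W).inv ≫
      ((α_ Q U V).inv ≫ (β_ Q U).hom ▷ V ≫ (α_ U Q V).hom) ▷ W)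

/-- For a family of operations `t n : Pₙ ⊗ Yⁿ ⟶ Y`, the morphism
`(p, q, y₁, ..., y_{a+n+b}) ↦ (p, y₁, ..., y_a, t(q; y_{a+1}, ..., y_{a+n}), ..., y_{a+n+b})`. -/
def plug {Y : A} (t : ∀ n, P.obj n ⊗ tpow Y n ⟶ Y) (a b n : ℕ) :
    (P.obj (a + 1 + b) ⊗ P.obj n) ⊗ ((tpow Y a ⊗ tpow Y n) ⊗ tpow Y b) ⟶
      P.obj (a + 1 + b) ⊗ tpow Y (a + 1 + b) :=
  shuffle _ _ _ _ _ ≫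
    P.obj (a + 1 + b) ◁ ((tpow Y a ◁ t n) ▷ tpow Y b ≫ (tpowJoin Y (a + 1) b).hom)

/-- The morphism `y ↦ (id, y)`. -/
def unitInsert (Y : A) : Y ⟶ P.obj 1 ⊗ tpow Y 1 :=
  (λ_ Y).inv ≫ (P.unit ⊗ₘ (λ_ Y).inv)

/-- An algebra over the operad `P`. -/
structure Alg where
  carrier : A
  act : ∀ n, P.obj n ⊗ tpow carrier n ⟶ carrier
  act_equivariant : ∀ {n : ℕ} (σ : Equiv.Perm (Fin n)),
    (P.map σ ⊗ₘ tpowPerm carrier σ) ≫ act n = act n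
  act_unit : unitInsert P carrier ≫ act 1 = 𝟙 carrier
  act_comp : ∀ a b n : ℕ,
    (P.comp a b n ⊗ₘ (tpowJoinThree carrier a n b).hom) ≫ act (a + n + b) =
      plug P act a b n ≫ act (a + 1 + b)

namespace Alg

variable {P}

/-- A morphism of algebras over `P`. -/
@[ext]
structure Hom (X Y : Alg P) where
  hom : X.carrier ⟶ Y.carrier
  comm : ∀ n, X.act n ≫ hom = P.obj n ◁ tpowMap hom n ≫ Y.act n

attribute [simp] Hom.comm

instance : Category (Alg P) where
  Hom := Hom
  id X := ⟨𝟙 _, fun n => by simp [tpowMap_id]⟩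
  comp f g := ⟨f.hom ≫ g.hom, fun n => by
    rw [← Category.assoc, f.comm, Category.assoc, g.comm, tpowMap_comp]; simp⟩

@[ext]
theorem hom_ext {X Y : Alg P} {f g : X ⟶ Y} (h : Hom.hom f = Hom.hom g) : f = g :=
  Hom.ext h

@[simp] theorem id_hom (X : Alg P) : Hom.hom (𝟙 X) = 𝟙 X.carrier := rfl

@[simp] theorem comp_hom {X Y Z : Alg P} (f : X ⟶ Y) (g : Y ⟶ Z) :
    Hom.hom (f ≫ g) = Hom.hom f ≫ Hom.hom g := rfl

end Alg

theorem unitInsert_naturality {Y Z : A} (f : Y ⟶ Z) :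
    f ≫ unitInsert P Z = unitInsert P Y ≫ P.obj 1 ◁ tpowMap f 1 := by
  have e : tpowMap f 1 = 𝟙_ A ◁ f := by
    change 𝟙 (𝟙_ A) ⊗ₘ f = _
    rw [id_tensorHom]
  rw [e]
  simp only [unitInsert, Category.assoc]
  rw [← id_tensorHom, ← id_tensorHom]
  erw [tensorHom_comp_tensorHom]
  rw [Category.comp_id, id_tensorHom, ← leftUnitor_inv_naturality,
    leftUnitor_inv_naturality_assoc, ← id_tensorHom, tensorHom_comp_tensorHom,
    Category.id_comp]

theorem shuffle_naturality (R Q : A) {U V W X Y Z : A} (u : U ⟶ X) (v : V ⟶ Y) (w : W ⟶ Z) :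
    shuffle R Q U V W ≫ R ◁ ((u ⊗ₘ (Q ◁ v)) ⊗ₘ w) =
      (R ⊗ Q) ◁ ((u ⊗ₘ v) ⊗ₘ w) ≫ shuffle R Q X Y Z := by
  have h1 : ((α_ Q U V).inv ≫ (β_ Q U).hom ▷ V ≫ (α_ U Q V).hom) ≫ (u ⊗ₘ (Q ◁ v)) =
      Q ◁ (u ⊗ₘ v) ≫ (α_ Q X Y).inv ≫ (β_ Q X).hom ▷ Y ≫ (α_ X Q Y).hom := by
    simp only [Category.assoc, ← id_tensorHom, ← tensorHom_id]
    rw [← associator_naturality, associator_inv_naturality_assoc]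
    congr 1
    simp only [← Category.assoc]
    congr 1
    rw [tensorHom_comp_tensorHom, tensorHom_comp_tensorHom,
      BraidedCategory.braiding_naturality, Category.id_comp, Category.comp_id]
  have h2 : ((α_ Q (U ⊗ V) W).inv ≫
      ((α_ Q U V).inv ≫ (β_ Q U).hom ▷ V ≫ (α_ U Q V).hom) ▷ W) ≫ ((u ⊗ₘ (Q ◁ v)) ⊗ₘ w) =
      Q ◁ ((u ⊗ₘ v) ⊗ₘ w) ≫ (α_ Q (X ⊗ Y) Z).inv ≫
      ((α_ Q X Y).inv ≫ (β_ Q X).hom ▷ Y ≫ (α_ X Q Y).hom) ▷ Z := by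
    rw [Category.assoc, ← tensorHom_id _ W, tensorHom_comp_tensorHom, h1,
      ← id_tensorHom Q ((u ⊗ₘ v) ⊗ₘ w), associator_inv_naturality_assoc, ← tensorHom_id _ Z, tensorHom_comp_tensorHom,
      id_tensorHom, Category.id_comp, Category.comp_id]
  simp only [shuffle, Category.assoc]
  rw [← whiskerLeft_comp, h2, whiskerLeft_comp]
  simp

theorem plug_naturality {Y Z : A} (f : Y ⟶ Z) (t : ∀ n, P.obj n ⊗ tpow Y n ⟶ Y)
    (s : ∀ n, P.obj n ⊗ tpow Z n ⟶ Z) (h : ∀ n, t n ≫ f = P.obj n ◁ tpowMap f n ≫ s n)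
    (a b n : ℕ) :
    plug P t a b n ≫ P.obj (a + 1 + b) ◁ tpowMap f (a + 1 + b) =
      (P.obj (a + 1 + b) ⊗ P.obj n) ◁ ((tpowMap f a ⊗ₘ tpowMap f n) ⊗ₘ tpowMap f b) ≫
        plug P s a b n := by
  have e1 : tpowMap f (a + 1) = tpowMap f a ⊗ₘ f := rfl
  have h1 : (tpow Y a ◁ t n) ▷ tpow Y b ≫ (tpowJoin Y (a + 1) b).hom ≫
      tpowMap f (a + 1 + b) =
      ((tpowMap f a ⊗ₘ (P.obj n ◁ tpowMap f n)) ⊗ₘ tpowMap f b) ≫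
        (tpow Z a ◁ s n) ▷ tpow Z b ≫ (tpowJoin Z (a + 1) b).hom := by
    rw [tpowJoin_naturality, e1]
    simp only [← Category.assoc]
    congr 1
    rw [← tensorHom_id, ← tensorHom_id, tensorHom_comp_tensorHom, tensorHom_comp_tensorHom,
      ← id_tensorHom (tpow Y a) (t n), ← id_tensorHom (tpow Z a) (s n),
      tensorHom_comp_tensorHom, tensorHom_comp_tensorHom, h]
    simp only [Category.id_comp, Category.comp_id]
  simp only [plug, Category.assoc, ← whiskerLeft_comp, h1]
  have h2 := shuffle_naturality (P.obj (a + 1 + b)) (P.obj n) (tpowMap f a) (tpowMap f n)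
    (tpowMap f b)
  rw [whiskerLeft_comp, ← Category.assoc, h2, Category.assoc]

end Operads

section Schur

variable {A : Type u} [Category.{v} A] [Abelian A] [HasColimits A]

/-- The direct sum over `n` of the coinvariants of `Z n` under the endomorphisms `f n σ`. -/
abbrev coinvSum (Z : ℕ → A) (f : ∀ n, Equiv.Perm (Fin n) → (Z n ⟶ Z n)) : A :=
  ∐ fun n => cokernel (Sigma.desc fun σ : Equiv.Perm (Fin n) => f n σ - 𝟙 (Z n))

/-- The canonical morphism from the `n`-th summand. -/
def coinvIncl (Z : ℕ → A) (f : ∀ n, Equiv.Perm (Fin n) → (Z n ⟶ Z n)) (n : ℕ) :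
    Z n ⟶ coinvSum Z f :=
  cokernel.π (Sigma.desc fun σ : Equiv.Perm (Fin n) => f n σ - 𝟙 (Z n)) ≫
    Sigma.ι (fun n => cokernel (Sigma.desc fun σ : Equiv.Perm (Fin n) => f n σ - 𝟙 (Z n))) n

theorem coinvIncl_equivariant (Z : ℕ → A) (f : ∀ n, Equiv.Perm (Fin n) → (Z n ⟶ Z n)) (n : ℕ)
    (σ : Equiv.Perm (Fin n)) : f n σ ≫ coinvIncl Z f n = coinvIncl Z f n := by
  have h : (f n σ - 𝟙 (Z n)) ≫
      cokernel.π (Sigma.desc fun σ : Equiv.Perm (Fin n) => f n σ - 𝟙 (Z n)) = 0 := by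
    rw [← Sigma.ι_desc (fun σ : Equiv.Perm (Fin n) => f n σ - 𝟙 (Z n)) σ, Category.assoc,
      cokernel.condition, comp_zero]
  rw [Preadditive.sub_comp, Category.id_comp, sub_eq_zero] at h
  rw [coinvIncl, ← Category.assoc, h]

/-- The morphism induced by a family of invariant morphisms. -/
def coinvDesc {Z : ℕ → A} {f : ∀ n, Equiv.Perm (Fin n) → (Z n ⟶ Z n)} {W : A}
    (g : ∀ n, Z n ⟶ W) (h : ∀ n σ, f n σ ≫ g n = g n) : coinvSum Z f ⟶ W :=
  Sigma.desc fun n => cokernel.desc _ (g n) (Sigma.hom_ext _ _ fun σ => by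
    simp [Preadditive.sub_comp, h])

theorem coinvIncl_desc {Z : ℕ → A} {f : ∀ n, Equiv.Perm (Fin n) → (Z n ⟶ Z n)} {W : A}
    (g : ∀ n, Z n ⟶ W) (h : ∀ n σ, f n σ ≫ g n = g n) (n : ℕ) :
    coinvIncl Z f n ≫ coinvDesc g h = g n := by
  simp [coinvIncl, coinvDesc]

theorem coinvSum_hom_ext {Z : ℕ → A} {f : ∀ n, Equiv.Perm (Fin n) → (Z n ⟶ Z n)} {W : A}
    {g h : coinvSum Z f ⟶ W} (w : ∀ n, coinvIncl Z f n ≫ g = coinvIncl Z f n ≫ h) : g = h :=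
  Sigma.hom_ext _ _ fun n => by
    have := w n
    simp only [coinvIncl, Category.assoc] at this
    exact (cancel_epi _).1 this

/-- The morphism induced by a family of equivariant morphisms. -/
def coinvMap {Z W : ℕ → A} {f : ∀ n, Equiv.Perm (Fin n) → (Z n ⟶ Z n)}
    {g : ∀ n, Equiv.Perm (Fin n) → (W n ⟶ W n)} (k : ∀ n, Z n ⟶ W n)
    (h : ∀ n σ, f n σ ≫ k n = k n ≫ g n σ) : coinvSum Z f ⟶ coinvSum W g :=
  coinvDesc (fun n => k n ≫ coinvIncl W g n) fun n σ => by
    rw [← Category.assoc, h, Category.assoc, coinvIncl_equivariant]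

theorem coinvIncl_map {Z W : ℕ → A} {f : ∀ n, Equiv.Perm (Fin n) → (Z n ⟶ Z n)}
    {g : ∀ n, Equiv.Perm (Fin n) → (W n ⟶ W n)} (k : ∀ n, Z n ⟶ W n)
    (h : ∀ n σ, f n σ ≫ k n = k n ≫ g n σ) (n : ℕ) :
    coinvIncl Z f n ≫ coinvMap k h = k n ≫ coinvIncl W g n :=
  coinvIncl_desc _ _ n

variable [MonoidalCategory A] [SymmetricCategory A]

theorem tensor_equivariant {R Z W : A} {r : R ⟶ R} {z : Z ⟶ Z} {w : W ⟶ W} {k : Z ⟶ W}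
    (h : z ≫ k = k ≫ w) : (r ⊗ₘ z) ≫ R ◁ k = R ◁ k ≫ (r ⊗ₘ w) := by
  rw [← id_tensorHom, tensorHom_comp_tensorHom, tensorHom_comp_tensorHom, h,
    Category.id_comp, Category.comp_id]

/-- `(X ⊕ B)^{⊗n} / B^{⊗n}`. -/
abbrev relPow (B X : A) (n : ℕ) : A :=
  cokernel (tpowMap (biprod.inr : B ⟶ X ⊞ B) n)

/-- The projection of `(X ⊕ B)^{⊗n}` onto the quotient by `B^{⊗n}`. -/
def relPowProj (B X : A) (n : ℕ) : tpow (X ⊞ B) n ⟶ relPow B X n :=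
  cokernel.π _

/-- The action of the symmetric group on the quotient. -/
def relPowPerm (B X : A) {n : ℕ} (σ : Equiv.Perm (Fin n)) : relPow B X n ⟶ relPow B X n :=
  cokernel.map _ _ (tpowPerm B σ) (tpowPerm (X ⊞ B) σ) (tpowPerm_naturality _ σ).symm

theorem relPowProj_perm (B X : A) {n : ℕ} (σ : Equiv.Perm (Fin n)) :
    tpowPerm (X ⊞ B) σ ≫ relPowProj B X n = relPowProj B X n ≫ relPowPerm B X σ := by
  simp [relPowProj, relPowPerm]

/-- The morphism of quotients induced by `g` and `f`. -/
def relPowMap {B X B' X' : A} (g : B ⟶ B') (f : X ⟶ X') (n : ℕ) :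
    relPow B X n ⟶ relPow B' X' n :=
  cokernel.map _ _ (tpowMap g n) (tpowMap (biprod.map f g) n) (by
    rw [← tpowMap_comp, ← tpowMap_comp, biprod.inr_map])

theorem relPowProj_map {B X B' X' : A} (g : B ⟶ B') (f : X ⟶ X') (n : ℕ) :
    relPowProj B X n ≫ relPowMap g f n = tpowMap (biprod.map f g) n ≫ relPowProj B' X' n := by
  simp [relPowProj, relPowMap]

theorem relPow_hom_ext {B X : A} {n : ℕ} {W : A} {g h : relPow B X n ⟶ W}
    (w : relPowProj B X n ≫ g = relPowProj B X n ≫ h) : g = h :=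
  coequalizer.hom_ext w

/-- The embedding of the quotient as the complement of `B^{⊗n}` in `(X ⊕ B)^{⊗n}`, which is
the kernel of the morphism to `B^{⊗n}` given by the projection. -/
def relPowEmb (B X : A) (n : ℕ) : relPow B X n ⟶ tpow (X ⊞ B) n :=
  cokernel.desc _ (𝟙 _ - tpowMap (biprod.snd ≫ biprod.inr) n) (by
    rw [Preadditive.comp_sub, Category.comp_id, ← tpowMap_comp, biprod.inr_snd_assoc, sub_self])

theorem relPowProj_emb (B X : A) (n : ℕ) :
    relPowProj B X n ≫ relPowEmb B X n = 𝟙 _ - tpowMap (biprod.snd ≫ biprod.inr) n := by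
  simp [relPowProj, relPowEmb]

variable (P : SymmOperad A)

/-- The Schur functor `P(Y) = ⨁ₙ Pₙ ⊗_{Σₙ} Y^{⊗n}`. -/
abbrev schur (Y : A) : A :=
  coinvSum (fun n => P.obj n ⊗ tpow Y n) fun _ σ => P.map σ ⊗ₘ tpowPerm Y σ

/-- The canonical morphism from `Pₙ ⊗ Y^{⊗n}` to `P(Y)`. -/
def schurIncl (Y : A) (n : ℕ) : P.obj n ⊗ tpow Y n ⟶ schur P Y :=
  coinvIncl (fun n => P.obj n ⊗ tpow Y n) (fun _ σ => P.map σ ⊗ₘ tpowPerm Y σ) n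

/-- The Schur functor on morphisms. -/
def schurMap {Y Z : A} (f : Y ⟶ Z) : schur P Y ⟶ schur P Z :=
  coinvMap (fun n => P.obj n ◁ tpowMap f n) fun _ σ =>
    tensor_equivariant (tpowPerm_naturality f σ)

/-- `P ∘ (B | X) = ⨁ₙ Pₙ ⊗_{Σₙ} ((X ⊕ B)^{⊗n} / B^{⊗n})`. -/
abbrev relSchur (B X : A) : A :=
  coinvSum (fun n => P.obj n ⊗ relPow B X n) fun _ σ => P.map σ ⊗ₘ relPowPerm B X σ

/-- The canonical morphism from `Pₙ ⊗ (X ⊕ B)^{⊗n}` to `P ∘ (B | X)`. -/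
def relIncl (B X : A) (n : ℕ) : P.obj n ⊗ tpow (X ⊞ B) n ⟶ relSchur P B X :=
  P.obj n ◁ relPowProj B X n ≫
    coinvIncl (fun n => P.obj n ⊗ relPow B X n) (fun _ σ => P.map σ ⊗ₘ relPowPerm B X σ) n

/-- The morphism `P ∘ (g | f)`. -/
def relMap {B X B' X' : A} (g : B ⟶ B') (f : X ⟶ X') : relSchur P B X ⟶ relSchur P B' X' :=
  coinvMap (fun n => P.obj n ◁ relPowMap g f n) fun n σ =>
    tensor_equivariant (relPow_hom_ext (by
      rw [← Category.assoc, ← relPowProj_perm, Category.assoc, relPowProj_map,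
        ← Category.assoc, tpowPerm_naturality, Category.assoc, relPowProj_perm,
        ← Category.assoc, ← Category.assoc, relPowProj_map]))

/-- The morphism `P(X) ⟶ P ∘ (B | X)` induced by the inclusion of `X` in `X ⊕ B`. -/
def schurToRel (B X : A) : schur P X ⟶ relSchur P B X :=
  coinvMap (fun n => P.obj n ◁ (tpowMap (biprod.inl : X ⟶ X ⊞ B) n ≫ relPowProj B X n))
    fun _ σ => tensor_equivariant (by
      rw [← Category.assoc, tpowPerm_naturality, Category.assoc, Category.assoc, relPowProj_perm])

/-- The inclusion of `P ∘ (B | X)` in `P(X ⊕ B)`, as the complement of `P(B)`. -/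
def relToSchur (B X : A) : relSchur P B X ⟶ schur P (X ⊞ B) :=
  coinvMap (fun n => P.obj n ◁ relPowEmb B X n) fun n σ =>
    tensor_equivariant (relPow_hom_ext (by
      rw [← Category.assoc, ← relPowProj_perm, Category.assoc, relPowProj_emb,
        ← Category.assoc, relPowProj_emb, Preadditive.comp_sub, Preadditive.sub_comp,
        tpowPerm_naturality, Category.id_comp, Category.comp_id]))

theorem schurIncl_map {Y Z : A} (f : Y ⟶ Z) (n : ℕ) :
    schurIncl P Y n ≫ schurMap P f = P.obj n ◁ tpowMap f n ≫ schurIncl P Z n :=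
  coinvIncl_map _ _ n

theorem relIncl_map {B X B' X' : A} (g : B ⟶ B') (f : X ⟶ X') (n : ℕ) :
    relIncl P B X n ≫ relMap P g f =
      P.obj n ◁ tpowMap (biprod.map f g) n ≫ relIncl P B' X' n := by
  rw [relIncl, relMap, Category.assoc, coinvIncl_map, ← Category.assoc, ← whiskerLeft_comp,
    relPowProj_map, whiskerLeft_comp, Category.assoc, relIncl]

theorem relMap_id (B X : A) : relMap P (𝟙 B) (𝟙 X) = 𝟙 _ :=
  coinvSum_hom_ext fun n => by
    have e : biprod.map (𝟙 X) (𝟙 B) = 𝟙 (X ⊞ B) := by ext <;> simp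
    have h : relPowMap (𝟙 B) (𝟙 X) n = 𝟙 (relPow B X n) := relPow_hom_ext (by
      rw [relPowProj_map, e, tpowMap_id, Category.id_comp, Category.comp_id])
    rw [relMap, coinvIncl_map, h, whiskerLeft_id, Category.id_comp, Category.comp_id]

theorem relMap_comp {B X C Y D Z : A} (g : B ⟶ C) (f : X ⟶ Y) (k : C ⟶ D) (h : Y ⟶ Z) :
    relMap P (g ≫ k) (f ≫ h) = relMap P g f ≫ relMap P k h :=
  coinvSum_hom_ext fun n => by
    have e : biprod.map (f ≫ h) (g ≫ k) = biprod.map f g ≫ biprod.map h k := by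
      ext <;> simp
    have w : relPowMap (g ≫ k) (f ≫ h) n = relPowMap g f n ≫ relPowMap k h n :=
      relPow_hom_ext (by
        rw [relPowProj_map, e, tpowMap_comp, ← Category.assoc, relPowProj_map, Category.assoc,
          Category.assoc, relPowProj_map])
    rw [relMap, relMap, relMap, coinvIncl_map, ← Category.assoc, coinvIncl_map, Category.assoc,
      coinvIncl_map, w, whiskerLeft_comp, Category.assoc]

theorem schurIncl_toRel (B X : A) (n : ℕ) :
    schurIncl P X n ≫ schurToRel P B X =
      P.obj n ◁ tpowMap (biprod.inl : X ⟶ X ⊞ B) n ≫ relIncl P B X n := by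
  rw [schurIncl, schurToRel, coinvIncl_map, relIncl, whiskerLeft_comp, Category.assoc]

theorem relIncl_toSchur (B X : A) (n : ℕ) :
    relIncl P B X n ≫ relToSchur P B X =
      P.obj n ◁ (𝟙 _ - tpowMap (biprod.snd ≫ biprod.inr) n) ≫ schurIncl P (X ⊞ B) n := by
  rw [relIncl, relToSchur, Category.assoc, coinvIncl_map, ← Category.assoc, ← whiskerLeft_comp,
    relPowProj_emb, schurIncl]

theorem relIncl_equivariant (B X : A) {n : ℕ} (σ : Equiv.Perm (Fin n)) :
    (P.map σ ⊗ₘ tpowPerm (X ⊞ B) σ) ≫ relIncl P B X n = relIncl P B X n := by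
  rw [relIncl, ← Category.assoc, tensor_equivariant (relPowProj_perm B X σ), Category.assoc,
    coinvIncl_equivariant (fun n => P.obj n ⊗ relPow B X n)
      (fun _ σ => P.map σ ⊗ₘ relPowPerm B X σ)]

/-- The structure map `P(X) ⟶ X` of an algebra. -/
def Alg.str {P : SymmOperad A} (X : Alg P) : schur P X.carrier ⟶ X.carrier :=
  coinvDesc X.act fun _ σ => X.act_equivariant σ

theorem Alg.schurIncl_str {P : SymmOperad A} (X : Alg P) (n : ℕ) :
    schurIncl P X.carrier n ≫ X.str = X.act n :=
  coinvIncl_desc _ _ n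

end Schur

section CrossedModules

variable {A : Type u} [Category.{v} A] [Abelian A] [HasColimits A] [MonoidalCategory A]
  [SymmetricCategory A] {P : SymmOperad A}

/-- The family of operations on `X ⊕ B` given by a morphism `r : P ∘ (B | X) ⟶ X` and the
algebra structure of `B`, that is, the components of the matrix `(r, 0; 0, str B)` on
`P(X ⊕ B) = P ∘ (B | X) ⊕ P(B)`. -/
def sumAct (B : Alg P) {X : A} (r : relSchur P B.carrier X ⟶ X) (n : ℕ) :
    P.obj n ⊗ tpow (X ⊞ B.carrier) n ⟶ X ⊞ B.carrier :=
  biprod.lift (relIncl P B.carrier X n ≫ r)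
    (P.obj n ◁ tpowMap (biprod.snd : X ⊞ B.carrier ⟶ B.carrier) n ≫ B.act n)

/-- An internal action of the algebra `B` on the algebra `X`: a morphism
`P ∘ (B | X) ⟶ X` which extends the structure map of `X` and is associative. The associativity
`P ∘ (P(B) | P ∘ (B | X)) ⟶ P ∘ (B | X) ⟶ X` is expressed, as in the definition of an algebra,
by plugging one operation at a time. -/
structure InternalAction (B X : Alg P) where
  hom : relSchur P B.carrier X.carrier ⟶ X.carrier
  triangle : schurToRel P B.carrier X.carrier ≫ hom = X.str
  assoc : ∀ a b n : ℕ,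
    (P.comp a b n ⊗ₘ (tpowJoinThree (X.carrier ⊞ B.carrier) a n b).hom) ≫
        relIncl P B.carrier X.carrier (a + n + b) ≫ hom =
      plug P (sumAct B hom) a b n ≫ relIncl P B.carrier X.carrier (a + 1 + b) ≫ hom

/-- The morphism `P ∘ (B | B) ⟶ P(B ⊕ B) ⟶ P(B) ⟶ B` of the natural action of `B` on
itself. -/
def selfAction (B : Alg P) : relSchur P B.carrier B.carrier ⟶ B.carrier :=
  relToSchur P B.carrier B.carrier ≫ schurMap P (biprod.desc (𝟙 _) (𝟙 _)) ≫ B.str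

variable (P) in
/-- A precrossed module: an action of `B` on `X` with an equivariant morphism `d`. -/
structure PXMod where
  B : Alg P
  X : Alg P
  action : InternalAction B X
  d : X ⟶ B
  equivariant : action.hom ≫ Alg.Hom.hom d =
    relMap P (𝟙 B.carrier) (Alg.Hom.hom d) ≫ selfAction B

namespace PXMod

/-- A morphism of precrossed modules. -/
@[ext]
structure Hom (M N : PXMod P) where
  g : M.B ⟶ N.B
  f : M.X ⟶ N.X
  action_comm : relMap P (Alg.Hom.hom g) (Alg.Hom.hom f) ≫ N.action.hom =
    M.action.hom ≫ Alg.Hom.hom f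
  d_comm : M.d ≫ g = f ≫ N.d

instance : Category (PXMod P) where
  Hom := Hom
  id M := ⟨𝟙 _, 𝟙 _, by simp [relMap_id], by simp⟩
  comp f g := ⟨f.g ≫ g.g, f.f ≫ g.f,
    by rw [Alg.comp_hom, Alg.comp_hom, relMap_comp, Category.assoc, g.action_comm,
      ← Category.assoc, f.action_comm, Category.assoc],
    by rw [← Category.assoc, f.d_comm, Category.assoc, g.d_comm, Category.assoc]⟩
  id_comp f := Hom.ext (Category.id_comp _) (Category.id_comp _)
  comp_id f := Hom.ext (Category.comp_id _) (Category.comp_id _)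
  assoc f g h := Hom.ext (Category.assoc _ _ _) (Category.assoc _ _ _)

end PXMod

variable (P) in
/-- A reflexive graph of algebras. -/
structure ReflGraph where
  E : Alg P
  B : Alg P
  s : E ⟶ B
  t : E ⟶ B
  i : B ⟶ E
  i_s : i ≫ s = 𝟙 B
  i_t : i ≫ t = 𝟙 B

namespace ReflGraph

/-- A morphism of reflexive graphs. -/
@[ext]
structure Hom (G H : ReflGraph P) where
  e : G.E ⟶ H.E
  b : G.B ⟶ H.B
  s_comm : G.s ≫ b = e ≫ H.s
  t_comm : G.t ≫ b = e ≫ H.t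
  i_comm : G.i ≫ e = b ≫ H.i

instance : Category (ReflGraph P) where
  Hom := Hom
  id G := ⟨𝟙 _, 𝟙 _, by simp, by simp, by simp⟩
  comp f g := ⟨f.e ≫ g.e, f.b ≫ g.b,
    by rw [← Category.assoc, f.s_comm, Category.assoc, g.s_comm, Category.assoc],
    by rw [← Category.assoc, f.t_comm, Category.assoc, g.t_comm, Category.assoc],
    by rw [← Category.assoc, f.i_comm, Category.assoc, g.i_comm, Category.assoc]⟩
  id_comp f := Hom.ext (Category.id_comp _) (Category.id_comp _)
  comp_id f := Hom.ext (Category.comp_id _) (Category.comp_id _)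
  assoc f g h := Hom.ext (Category.assoc _ _ _) (Category.assoc _ _ _)

end ReflGraph

variable (P) in
/-- Crossed modules: the precrossed modules which satisfy the Peiffer identity
`ρ(γ; x₁, ..., x_i, b_{i+1}, ..., b_n) = ρ(γ; x₁, d x₂, ..., d x_i, b_{i+1}, ..., b_n)` for
`n ≥ i ≥ 2`. Here `i = 1 + k` and `n = i + j`. -/
def IsCrossed : ObjectProperty (PXMod P) := fun M =>
  ∀ k j : ℕ, 1 ≤ k →
    P.obj (1 + k + j) ◁
          ((((biprod.inl : M.X.carrier ⟶ M.X.carrier ⊞ M.B.carrier) ⊗ₘ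
              tpowMap (biprod.inl : M.X.carrier ⟶ M.X.carrier ⊞ M.B.carrier) k) ⊗ₘ
              tpowMap (biprod.inr : M.B.carrier ⟶ M.X.carrier ⊞ M.B.carrier) j) ≫
            (tpowCons (M.X.carrier ⊞ M.B.carrier) k).hom ▷
              tpow (M.X.carrier ⊞ M.B.carrier) j ≫
            (tpowJoin (M.X.carrier ⊞ M.B.carrier) (1 + k) j).hom) ≫
        relIncl P M.B.carrier M.X.carrier (1 + k + j) ≫ M.action.hom =
      P.obj (1 + k + j) ◁
          ((((𝟙 M.X.carrier) ⊗ₘ tpowMap (Alg.Hom.hom M.d) k) ⊗ₘ 𝟙 (tpow M.B.carrier j)) ≫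
            (((biprod.inl : M.X.carrier ⟶ M.X.carrier ⊞ M.B.carrier) ⊗ₘ
              tpowMap (biprod.inr : M.B.carrier ⟶ M.X.carrier ⊞ M.B.carrier) k) ⊗ₘ
              tpowMap (biprod.inr : M.B.carrier ⟶ M.X.carrier ⊞ M.B.carrier) j) ≫
            (tpowCons (M.X.carrier ⊞ M.B.carrier) k).hom ▷
              tpow (M.X.carrier ⊞ M.B.carrier) j ≫
            (tpowJoin (M.X.carrier ⊞ M.B.carrier) (1 + k) j).hom) ≫
        relIncl P M.B.carrier M.X.carrier (1 + k + j) ≫ M.action.hom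

variable (P) in
/-- The `Cat¹`-algebras: the reflexive graphs such that the operations of arity `n ≥ 2` vanish on
`ker s ⊗ ker t ⊗ E^{⊗(n-2)}`. Here `n = 1 + (1 + m)`. -/
def IsCatOne : ObjectProperty (ReflGraph P) := fun G =>
  ∀ m : ℕ,
    P.obj (1 + (1 + m)) ◁
        ((kernel.ι (Alg.Hom.hom G.s) ⊗ₘ (kernel.ι (Alg.Hom.hom G.t) ⊗ₘ
            𝟙 (tpow G.E.carrier m))) ≫
          G.E.carrier ◁ (tpowCons G.E.carrier m).hom ≫
          (tpowCons G.E.carrier (1 + m)).hom) ≫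
      G.E.act (1 + (1 + m)) = 0

variable (P) in
/-- The category of crossed modules. -/
abbrev XMod := (IsCrossed P).FullSubcategory

variable (P) in
/-- The category of `Cat¹`-algebras. -/
abbrev CatOne := (IsCatOne P).FullSubcategory

variable [MonoidalClosed A]

theorem tensorLeft_add (R : A) : (tensorLeft R).Additive := by
  have : PreservesBinaryBiproducts (tensorLeft R) :=
    preservesBinaryBiproducts_of_preservesBinaryCoproducts _
  exact Functor.additive_of_preservesBinaryBiproducts _

theorem whisker_zero (R : A) {Y Z : A} : R ◁ (0 : Y ⟶ Z) = 0 := by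
  have := tensorLeft_add R
  exact (tensorLeft R).map_zero Y Z

theorem whisker_sub (R : A) {Y Z : A} (f g : Y ⟶ Z) : R ◁ (f - g) = R ◁ f - R ◁ g := by
  have := tensorLeft_add R
  exact (tensorLeft R).map_sub

theorem inr_relIncl (B X : A) (n : ℕ) :
    P.obj n ◁ tpowMap (biprod.inr : B ⟶ X ⊞ B) n ≫ relIncl P B X n = 0 := by
  rw [relIncl, ← Category.assoc, ← whiskerLeft_comp, relPowProj, cokernel.condition,
    whisker_zero, zero_comp]

theorem InternalAction.inl_comp {B X : Alg P} (r : InternalAction B X) (n : ℕ) :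
    P.obj n ◁ tpowMap (biprod.inl : X.carrier ⟶ X.carrier ⊞ B.carrier) n ≫
      relIncl P B.carrier X.carrier n ≫ r.hom = X.act n := by
  rw [← Category.assoc, ← schurIncl_toRel, Category.assoc, r.triangle, X.schurIncl_str]

theorem relIncl_selfAction (B : Alg P) (n : ℕ) :
    relIncl P B.carrier B.carrier n ≫ selfAction B =
      P.obj n ◁ tpowMap (biprod.desc (𝟙 _) (𝟙 _)) n ≫ B.act n -
        P.obj n ◁ tpowMap biprod.snd n ≫ B.act n := by
  rw [selfAction, ← Category.assoc, relIncl_toSchur, Category.assoc, ← Category.assoc (schurIncl _ _ _),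
    schurIncl_map, Category.assoc, B.schurIncl_str, ← Category.assoc, ← whiskerLeft_comp,
    Preadditive.sub_comp, Category.id_comp, ← tpowMap_comp, whisker_sub, Preadditive.sub_comp]
  simp

/-- The semidirect product `X ⋊ B`: the algebra structure on `X ⊕ B` defined by an action. -/
def semidirect {B X : Alg P} (r : InternalAction B X) : Alg P where
  carrier := X.carrier ⊞ B.carrier
  act := sumAct B r.hom
  act_equivariant {n} σ := by
    ext
    · simp only [sumAct, Category.assoc, biprod.lift_fst]
      rw [← Category.assoc, relIncl_equivariant]
    · simp only [sumAct, Category.assoc, biprod.lift_snd]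
      rw [← Category.assoc, tensor_equivariant (tpowPerm_naturality _ σ), Category.assoc,
        B.act_equivariant]
  act_unit := by
    have hi : ∀ {Y : A} (k : Y ⟶ X.carrier ⊞ B.carrier),
        k ≫ unitInsert P (X.carrier ⊞ B.carrier) ≫ sumAct B r.hom 1 =
        unitInsert P Y ≫ P.obj 1 ◁ tpowMap k 1 ≫ sumAct B r.hom 1 := by
      intro Y k
      rw [← Category.assoc, unitInsert_naturality, Category.assoc]
    apply biprod.hom_ext'
    · rw [hi, Category.comp_id]
      apply biprod.hom_ext
      · simp only [sumAct, Category.assoc, biprod.lift_fst, biprod.inl_fst]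
        rw [r.inl_comp, X.act_unit]
      · simp only [sumAct, Category.assoc, biprod.lift_snd, biprod.inl_snd]
        rw [← Category.assoc (_ ◁ _), ← whiskerLeft_comp, ← tpowMap_comp, biprod.inl_snd,
          ← Category.assoc, ← unitInsert_naturality, zero_comp, zero_comp]
    · rw [hi, Category.comp_id]
      apply biprod.hom_ext
      · simp only [sumAct, Category.assoc, biprod.lift_fst, biprod.inr_fst]
        rw [← Category.assoc (_ ◁ _), inr_relIncl, zero_comp, comp_zero]
      · simp only [sumAct, Category.assoc, biprod.lift_snd, biprod.inr_snd]
        rw [← Category.assoc (_ ◁ _), ← whiskerLeft_comp, ← tpowMap_comp, biprod.inr_snd,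
          ← Category.assoc, ← unitInsert_naturality, Category.id_comp, B.act_unit]
  act_comp a b n := by
    have hs : ∀ n, sumAct B r.hom n ≫ biprod.snd =
        P.obj n ◁ tpowMap (biprod.snd : X.carrier ⊞ B.carrier ⟶ B.carrier) n ≫ B.act n :=
      fun n => biprod.lift_snd _ _
    have hf : ∀ n, sumAct B r.hom n ≫ biprod.fst = relIncl P B.carrier X.carrier n ≫ r.hom :=
      fun n => biprod.lift_fst _ _
    ext
    · rw [Category.assoc, Category.assoc, hf, hf, r.assoc]
    · rw [Category.assoc, Category.assoc, hs, hs, ← Category.assoc (plug _ _ _ _ _),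
        plug_naturality P _ _ B.act hs, Category.assoc, ← B.act_comp, ← Category.assoc,
        ← Category.assoc]
      congr 1
      rw [← id_tensorHom, ← id_tensorHom, tensorHom_comp_tensorHom, tensorHom_comp_tensorHom,
        tpowJoinThree_naturality, Category.id_comp, Category.comp_id]

namespace PXMod

theorem sumAct_target (M : PXMod P) (n : ℕ) :
    sumAct M.B M.action.hom n ≫ biprod.desc (Alg.Hom.hom M.d) (𝟙 M.B.carrier) =
      P.obj n ◁ tpowMap (biprod.desc (Alg.Hom.hom M.d) (𝟙 M.B.carrier)) n ≫ M.B.act n := by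
  have h : biprod.map (Alg.Hom.hom M.d) (𝟙 M.B.carrier) ≫
      biprod.desc (𝟙 M.B.carrier) (𝟙 M.B.carrier) =
      biprod.desc (Alg.Hom.hom M.d) (𝟙 M.B.carrier) := by
    apply biprod.hom_ext' <;> simp
  have e : relIncl P M.B.carrier M.X.carrier n ≫ M.action.hom ≫ Alg.Hom.hom M.d =
      P.obj n ◁ tpowMap (biprod.desc (Alg.Hom.hom M.d) (𝟙 M.B.carrier)) n ≫ M.B.act n -
        P.obj n ◁ tpowMap biprod.snd n ≫ M.B.act n := by
    rw [M.equivariant, ← Category.assoc, relIncl_map, Category.assoc, relIncl_selfAction,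
      Preadditive.comp_sub, ← Category.assoc, ← Category.assoc, ← whiskerLeft_comp,
      ← whiskerLeft_comp, ← tpowMap_comp, ← tpowMap_comp, h, biprod.map_snd, Category.comp_id]
  rw [sumAct, biprod.lift_desc, Category.assoc, e, Category.comp_id, sub_add_cancel]

theorem inr_sumAct (M : PXMod P) (n : ℕ) :
    M.B.act n ≫ (biprod.inr : M.B.carrier ⟶ M.X.carrier ⊞ M.B.carrier) =
      P.obj n ◁ tpowMap biprod.inr n ≫ sumAct M.B M.action.hom n := by
  apply biprod.hom_ext
  · rw [Category.assoc, Category.assoc, biprod.inr_fst, comp_zero, sumAct, biprod.lift_fst,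
      ← Category.assoc, inr_relIncl, zero_comp]
  · rw [Category.assoc, Category.assoc, biprod.inr_snd, sumAct, biprod.lift_snd,
      ← Category.assoc, ← whiskerLeft_comp, ← tpowMap_comp, biprod.inr_snd, tpowMap_id]
    simp

theorem sumAct_map {M N : PXMod P} (h : M ⟶ N) (n : ℕ) :
    sumAct M.B M.action.hom n ≫ biprod.map (Alg.Hom.hom (Hom.f h)) (Alg.Hom.hom (Hom.g h)) =
      P.obj n ◁ tpowMap (biprod.map (Alg.Hom.hom (Hom.f h)) (Alg.Hom.hom (Hom.g h))) n ≫
        sumAct N.B N.action.hom n := by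
  apply biprod.hom_ext
  · rw [Category.assoc, Category.assoc, biprod.map_fst, sumAct, sumAct,
      biprod.lift_fst, biprod.lift_fst_assoc, Category.assoc,
      ← Hom.action_comm h, ← Category.assoc, relIncl_map, Category.assoc]
  · rw [Category.assoc, Category.assoc, biprod.map_snd, sumAct, sumAct,
      biprod.lift_snd, biprod.lift_snd_assoc, Category.assoc,
      Alg.Hom.comm, ← Category.assoc, ← Category.assoc, ← whiskerLeft_comp,
      ← whiskerLeft_comp, ← tpowMap_comp, ← tpowMap_comp, biprod.map_snd]

theorem map_target {M N : PXMod P} (h : M ⟶ N) :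
    biprod.desc (Alg.Hom.hom M.d) (𝟙 M.B.carrier) ≫ Alg.Hom.hom (Hom.g h) =
      biprod.map (Alg.Hom.hom (Hom.f h)) (Alg.Hom.hom (Hom.g h)) ≫
        biprod.desc (Alg.Hom.hom N.d) (𝟙 N.B.carrier) := by
  have e := congrArg Alg.Hom.hom (Hom.d_comm h)
  simp only [Alg.comp_hom] at e
  apply biprod.hom_ext' <;> simp [e]

/-- The reflexive graph of a precrossed module: the algebra `X ⋊ B` with source `0 ⊕ id`,
target `d ⊕ id`, and the inclusion of `B`. -/
def toReflGraphObj (M : PXMod P) : ReflGraph P where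
  E := semidirect M.action
  B := M.B
  s :=
    { hom := (biprod.snd : M.X.carrier ⊞ M.B.carrier ⟶ M.B.carrier)
      comm := fun _ => biprod.lift_snd _ _ }
  t :=
    { hom := biprod.desc (Alg.Hom.hom M.d) (𝟙 M.B.carrier)
      comm := sumAct_target M }
  i :=
    { hom := (biprod.inr : M.B.carrier ⟶ M.X.carrier ⊞ M.B.carrier)
      comm := inr_sumAct M }
  i_s := Alg.hom_ext biprod.inr_snd
  i_t := Alg.hom_ext (biprod.inr_desc _ _)

variable (P) in
/-- The functor from precrossed modules to reflexive graphs; a morphism `(g, f)` is sent to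
`(f ⊕ g, g)`. -/
def toReflGraph : PXMod P ⥤ ReflGraph P where
  obj := toReflGraphObj
  map {M N} h :=
    { e :=
        { hom := biprod.map (Alg.Hom.hom (Hom.f h)) (Alg.Hom.hom (Hom.g h))
          comm := sumAct_map h }
      b := Hom.g h
      s_comm := Alg.hom_ext (biprod.map_snd _ _).symm
      t_comm := Alg.hom_ext (map_target h)
      i_comm := Alg.hom_ext (biprod.inr_map _ _) }
  map_id M := ReflGraph.Hom.ext (Alg.hom_ext (by
      change biprod.map (𝟙 M.X.carrier) (𝟙 M.B.carrier) = 𝟙 (M.X.carrier ⊞ M.B.carrier)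
      apply biprod.hom_ext' <;> simp)) rfl
  map_comp {M N K} h k := ReflGraph.Hom.ext (Alg.hom_ext (by
      change biprod.map (Alg.Hom.hom (Hom.f h) ≫ Alg.Hom.hom (Hom.f k))
          (Alg.Hom.hom (Hom.g h) ≫ Alg.Hom.hom (Hom.g k)) =
        biprod.map (Alg.Hom.hom (Hom.f h)) (Alg.Hom.hom (Hom.g h)) ≫
          biprod.map (Alg.Hom.hom (Hom.f k)) (Alg.Hom.hom (Hom.g k))
      apply biprod.hom_ext' <;> simp)) rfl

end PXMod

end CrossedModules

end OperadCrossed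

end

/-! A reflexive graph is split by `i`: as an object of the abelian category, `E` is `ker s ⊕ B`.
Transported along this isomorphism, the operations of `E` have as `B`-component the operations of
`B` applied to the images under `s`. Their `ker s`-component vanishes when all inputs come from `B`,
so it is a morphism `P ∘ (B | ker s) ⟶ ker s`. Associativity and equivariance of this action are
inherited from `E`, and `d` is `t` restricted to `ker s`. Since `P₀ = 0`, the kernel is closed under
the operations. This gives essential surjectivity (`ReflGraph.toPXModIso`). Compatibility with `s`
and `i` makes every morphism of graphs diagonal, which gives fullness.

For the comparison of the two conditions, both are rewritten on `E = X ⋊ B` through three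
endomorphisms of `X ⊕ B`: the projections `p` onto `X` and `q` onto `B`, and `δ (x, b) = (0, d x)`.
The image of `p` is `ker s`, that of `p - δ` is `ker t`. The `Cat¹`-condition says that operations
vanish on `(p, p - δ, 1, ..., 1)`. The Peiffer identity says that they agree on `(p, p, ..., p, q,
..., q)` and `(p, δ, ..., δ, q, ..., q)`.

From `Cat¹` to Peiffer, the `p`'s are replaced by `δ` one at a time; each step changes the value by
a term with `p` in one slot and `p - δ` in another, which is zero up to a permutation
(`CatOneFam.peiffer`). Conversely, every slot is expanded by `1 = p + q`, and in each surviving term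
the two summands of `p - δ` have the same normal form under Peiffer (`PeifferFam.catOne`). -/

noncomputable section

namespace OperadCrossed

/-! ### Tensor products of families of morphisms and their compatibility with permutations. -/

section TensorFamilies

variable {A : Type u} [Category.{v} A] [MonoidalCategory A]

/-- The tensor product of a family of morphisms `Y ⟶ Z`. -/
def tpowFam {Y Z : A} : ∀ {n : ℕ}, (Fin n → (Y ⟶ Z)) → (tpow Y n ⟶ tpow Z n)
  | 0, _ => 𝟙 _
  | n + 1, e => tpowFam (fun j : Fin n => e j.castSucc) ⊗ₘ e (Fin.last n)

theorem tpowFam_succ {Y Z : A} {n : ℕ} (e : Fin (n + 1) → (Y ⟶ Z)) :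
    tpowFam e = tpowFam (fun j : Fin n => e j.castSucc) ⊗ₘ e (Fin.last n) := rfl

theorem tpowFam_const {Y Z : A} (f : Y ⟶ Z) : ∀ n, tpowFam (fun _ : Fin n => f) = tpowMap f n
  | 0 => rfl
  | n + 1 => by rw [tpowFam_succ, tpowFam_const f n]; rfl

theorem tpowFam_comp {X Y Z : A} : ∀ {n : ℕ} (e : Fin n → (X ⟶ Y)) (f : Fin n → (Y ⟶ Z)),
    tpowFam e ≫ tpowFam f = tpowFam fun j => e j ≫ f j
  | 0, _, _ => Category.id_comp _
  | n + 1, e, f => by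
      rw [tpowFam_succ, tpowFam_succ, tensorHom_comp_tensorHom, tpowFam_comp]; rfl

theorem tpowJoin_fam {Y Z : A} (m : ℕ) : ∀ (n : ℕ) (e : Fin m → (Y ⟶ Z)) (f : Fin n → (Y ⟶ Z)),
    (tpowJoin Y m n).hom ≫ tpowFam (Fin.append e f) =
      (tpowFam e ⊗ₘ tpowFam f) ≫ (tpowJoin Z m n).hom
  | 0, e, f => by
      -- `m + 0` is `m` by definition, so both families have the same type.
      have h : Fin.append e f = e := by
        funext j
        exact Fin.append_left e f j
      have e0 : tpowFam f = 𝟙 (𝟙_ A) := rfl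
      rw [h, e0, tensorHom_id]
      exact (rightUnitor_naturality (tpowFam e)).symm
  | n + 1, e, f => by
      have ih := tpowJoin_fam m n e fun j => f j.castSucc
      have e1 : tpowFam (Fin.append e f) =
          tpowFam (Fin.append e fun j => f j.castSucc) ⊗ₘ f (Fin.last n) := by
        refine (tpowFam_succ (n := m + n) _).trans ?_
        congr 2
        · funext j
          refine Fin.addCases (fun i => ?_) (fun i => ?_) j
          · rw [Fin.append_left]
            exact Fin.append_left e f i
          · rw [Fin.append_right]
            exact Fin.append_right e f i.castSucc
        · exact Fin.append_right e f (Fin.last n)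
      rw [e1, tpowFam_succ f]
      simp only [tpowJoin, Iso.trans_hom, Iso.symm_hom, whiskerRightIso_hom, Category.assoc]
      rw [associator_inv_naturality_assoc]
      congr 1
      rw [← tensorHom_id, ← tensorHom_id, tensorHom_comp_tensorHom,
        tensorHom_comp_tensorHom, ih, Category.id_comp, Category.comp_id]

theorem tpowCons_fam {Y Z : A} (n : ℕ) (e : Y ⟶ Z) (f : Fin n → (Y ⟶ Z)) :
    (tpowCons Y n).hom ≫ tpowFam (Fin.append (fun _ : Fin 1 => e) f) =
      (e ⊗ₘ tpowFam f) ≫ (tpowCons Z n).hom := by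
  have e1 : tpowFam (fun _ : Fin 1 => e) = 𝟙_ A ◁ e := by
    rw [tpowFam_succ, ← id_tensorHom]; rfl
  simp only [tpowCons, Iso.trans_hom, whiskerRightIso_hom, Iso.symm_hom, Category.assoc]
  rw [tpowJoin_fam, e1, ← tensorHom_id, ← tensorHom_id]
  erw [tensorHom_comp_tensorHom_assoc, tensorHom_comp_tensorHom_assoc]
  rw [leftUnitor_inv_naturality, Category.id_comp, Category.comp_id]

variable [SymmetricCategory A]

/-- The last factor lands in position `i` and the others slide to the positions `i.succAbove j`, so
each factor must carry the morphism of its new position. -/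
theorem tpowInsert_fam {Y Z : A} : ∀ (n : ℕ) (i : Fin (n + 1)) (e : Fin (n + 1) → (Y ⟶ Z)),
    tpowInsert Y n i ≫ tpowFam e =
      (tpowFam (fun j => e (i.succAbove j)) ⊗ₘ e i) ≫ tpowInsert Z n i
  | 0, i, e => by
      simp only [tpowInsert]
      obtain rfl : i = Fin.last 0 := Subsingleton.elim (α := Fin 1) _ _
      exact (Category.id_comp _).trans (Category.comp_id _).symm
  | n + 1, i, e => by
      induction i using Fin.lastCases with
      | last =>
        simp only [tpowInsert, Fin.lastCases_last, Fin.succAbove_last]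
        exact (Category.id_comp _).trans (Category.comp_id _).symm
      | cast j =>
        have ih := tpowInsert_fam n j fun l => e l.castSucc
        simp only [tpowInsert, Fin.lastCases_castSucc, Category.assoc]
        rw [tpowFam_succ e, tpowFam_succ (fun l => e (j.castSucc.succAbove l))]
        -- Inserting before the end swaps the last two factors and then inserts among the first `n +
        -- 1`; the factor swapped to the end stays there.
        have hl : j.castSucc.succAbove (Fin.last n) = Fin.last (n + 1) :=
          (Fin.succAbove_of_le_castSucc _ _
            (Fin.castSucc_le_castSucc_iff.2 (Fin.le_last j))).trans (Fin.succ_last n)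
        simp only [Fin.castSucc_succAbove_castSucc, hl]
        have h1 : tpowInsert Y n j ▷ Y ≫ (tpowFam (fun l => e l.castSucc) ⊗ₘ e (Fin.last _)) =
            ((tpowFam (fun l => e (j.succAbove l).castSucc) ⊗ₘ e j.castSucc) ⊗ₘ
              e (Fin.last _)) ≫ tpowInsert Z n j ▷ Z := by
          rw [← tensorHom_id, ← tensorHom_id, tensorHom_comp_tensorHom,
            tensorHom_comp_tensorHom, ih, Category.id_comp, Category.comp_id]
        rw [h1]
        simp only [← Category.assoc]
        congr 1
        simp only [Category.assoc]
        rw [← associator_inv_naturality, associator_naturality_assoc]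
        congr 1
        simp only [← Category.assoc]
        congr 1
        rw [← id_tensorHom, ← id_tensorHom, tensorHom_comp_tensorHom,
          tensorHom_comp_tensorHom, Category.id_comp, Category.comp_id,
          BraidedCategory.braiding_naturality]

theorem succAbove_permDeleteLast {n : ℕ} (σ : Equiv.Perm (Fin (n + 1))) (j : Fin n) :
    (σ (Fin.last n)).succAbove (permDeleteLast σ j) = σ j.castSucc := by
  have h := congrArg Subtype.val ((finSuccAboveEquiv (σ (Fin.last n))).apply_symm_apply
    (σ.subtypeEquiv (p := fun x => x ≠ Fin.last n) (q := fun x => x ≠ σ (Fin.last n))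
      (fun x => by simp) (finSuccAboveEquiv (Fin.last n) j)))
  refine Eq.trans h ?_
  simp [finSuccAboveEquiv_apply]

/-- Factor `j` moves to position `σ j`, where it meets `e (σ j)`. Through this, equivariance of an
algebra becomes a reindexing rule for families. -/
theorem tpowPerm_fam {Y Z : A} : ∀ {n} (σ : Equiv.Perm (Fin n)) (e : Fin n → (Y ⟶ Z)),
    tpowPerm Y σ ≫ tpowFam e = tpowFam (fun j => e (σ j)) ≫ tpowPerm Z σ
  | 0, _, _ => rfl
  | n + 1, σ, e => by
      have ih := tpowPerm_fam (permDeleteLast σ) fun j => e ((σ (Fin.last n)).succAbove j)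
      simp only [succAbove_permDeleteLast] at ih
      simp only [tpowPerm, Category.assoc]
      rw [tpowInsert_fam, tpowFam_succ fun j => e (σ j), ← Category.assoc, ← Category.assoc]
      congr 1
      rw [← tensorHom_id, ← tensorHom_id, tensorHom_comp_tensorHom,
        tensorHom_comp_tensorHom, ih, Category.id_comp, Category.comp_id]

end TensorFamilies

/-! ### Additivity of the tensor product and multilinear expansion. -/

section Additivity

variable {A : Type u} [Category.{v} A] [Abelian A] [HasColimits A] [MonoidalCategory A]
  [SymmetricCategory A] [MonoidalClosed A]

/-- Tensoring on the left is a left adjoint, hence additive; the braiding carries this over to the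
right side. -/
instance monoidalPreadditive_of_closed : MonoidalPreadditive A where
  whiskerLeft_zero := whisker_zero _
  whiskerLeft_add {X Y Z} f g := by
    have := tensorLeft_add X
    exact (tensorLeft X).map_add
  zero_whiskerRight {X Y Z} := by
    rw [← cancel_mono (β_ Z X).hom, BraidedCategory.braiding_naturality_left, whisker_zero,
      comp_zero, zero_comp]
  add_whiskerRight {X Y Z} f g := by
    have := tensorLeft_add X
    rw [← cancel_mono (β_ Z X).hom, Preadditive.add_comp,
      BraidedCategory.braiding_naturality_left, BraidedCategory.braiding_naturality_left,
      BraidedCategory.braiding_naturality_left, ← Preadditive.comp_add]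
    congr 1
    exact (tensorLeft X).map_add

theorem tpowFam_eq_zero {Y Z : A} : ∀ {n : ℕ} (e : Fin n → (Y ⟶ Z)) (a : Fin n), e a = 0 →
    tpowFam e = 0
  | n + 1, e, a, h => by
      rw [tpowFam_succ]
      induction a using Fin.lastCases with
      | last => rw [h, MonoidalPreadditive.tensor_zero]
      | cast a => rw [tpowFam_eq_zero _ a h, MonoidalPreadditive.zero_tensor]

theorem tpowFam_sub {Y Z : A} : ∀ {n : ℕ} (e f g : Fin n → (Y ⟶ Z)) (b : Fin n),
    e b = f b - g b → (∀ j, j ≠ b → f j = e j) → (∀ j, j ≠ b → g j = e j) →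
    tpowFam e = tpowFam f - tpowFam g
  | n + 1, e, f, g, b, h, hf, hg => by
      rw [tpowFam_succ, tpowFam_succ f, tpowFam_succ g]
      induction b using Fin.lastCases with
      | last =>
        have h1 : (fun j : Fin n => f j.castSucc) = fun j => e j.castSucc :=
          funext fun j => hf _ (Fin.castSucc_ne_last j)
        have h2 : (fun j : Fin n => g j.castSucc) = fun j => e j.castSucc :=
          funext fun j => hg _ (Fin.castSucc_ne_last j)
        rw [h1, h2, h, MonoidalCategory.tensorHom_def, MonoidalCategory.tensorHom_def,
          MonoidalCategory.tensorHom_def, whisker_sub, Preadditive.comp_sub]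
      | cast b =>
        rw [hf _ (Fin.castSucc_ne_last b).symm, hg _ (Fin.castSucc_ne_last b).symm,
          tpowFam_sub (fun j : Fin n => e j.castSucc) (fun j => f j.castSucc)
            (fun j => g j.castSucc) b h
            (fun j hj => hf _ fun h => hj (Fin.castSucc_injective n h))
            (fun j hj => hg _ fun h => hj (Fin.castSucc_injective n h)),
          eq_sub_iff_add_eq, ← MonoidalPreadditive.add_tensor, sub_add_cancel]

/-- This is the expansion of `(p + q) ⊗ ... ⊗ (p + q)`. Membership in a subgroup is enough for
testing vanishing and avoids writing the sum over all choices. -/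
theorem id_tpow_mem_closure {Y : A} {p q : Y ⟶ Y} (h : p + q = 𝟙 Y) : ∀ n,
    𝟙 (tpow Y n) ∈ AddSubgroup.closure
      {u | ∃ c : Fin n → (Y ⟶ Y), (∀ j, c j = p ∨ c j = q) ∧ tpowFam c = u}
  | 0 => AddSubgroup.subset_closure ⟨fun j => j.elim0, fun j => j.elim0, rfl⟩
  | n + 1 => by
      have key : ∀ u ∈ AddSubgroup.closure
          {u | ∃ c : Fin n → (Y ⟶ Y), (∀ j, c j = p ∨ c j = q) ∧ tpowFam c = u},
          u ⊗ₘ 𝟙 Y ∈ AddSubgroup.closure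
            {u | ∃ c : Fin (n + 1) → (Y ⟶ Y), (∀ j, c j = p ∨ c j = q) ∧ tpowFam c = u} := by
        intro u hu
        induction hu using AddSubgroup.closure_induction with
        | mem u hu =>
          obtain ⟨c, hc, rfl⟩ := hu
          have hs : ∀ r, (r = p ∨ r = q) → tpowFam c ⊗ₘ r ∈ AddSubgroup.closure
              {u | ∃ c : Fin (n + 1) → (Y ⟶ Y), (∀ j, c j = p ∨ c j = q) ∧ tpowFam c = u} := by
            intro r hr
            refine AddSubgroup.subset_closure
              ⟨Fin.snoc (α := fun _ => (Y ⟶ Y)) c r, fun j => ?_, ?_⟩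
            · induction j using Fin.lastCases with
              | last => simpa using hr
              | cast j => simpa using hc j
            · rw [tpowFam_succ]
              simp
          rw [← h, MonoidalPreadditive.tensor_add]
          exact add_mem (hs p (Or.inl rfl)) (hs q (Or.inr rfl))
        | zero => rw [MonoidalPreadditive.zero_tensor]; exact zero_mem _
        | add u w _ _ hu hw => rw [MonoidalPreadditive.add_tensor]; exact add_mem hu hw
        | neg u _ hu =>
          have e : (-u) ⊗ₘ 𝟙 Y = -(u ⊗ₘ 𝟙 Y) := by
            rw [eq_neg_iff_add_eq_zero, ← MonoidalPreadditive.add_tensor, neg_add_cancel,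
              MonoidalPreadditive.zero_tensor]
          rw [e]
          exact neg_mem hu
      have := key _ (id_tpow_mem_closure h n)
      rwa [id_tensorHom_id] at this

/-- A morphism out of a tensor power of `Y` is zero if it vanishes on all tensor products of the
summands of `Y` cut out by two complementary endomorphisms. -/
theorem eq_zero_of_tpowFam_comp {Y R W : A} {p q : Y ⟶ Y} (h : p + q = 𝟙 Y) {n : ℕ}
    (u : R ⊗ tpow Y n ⟶ W)
    (hu : ∀ c : Fin n → (Y ⟶ Y), (∀ j, c j = p ∨ c j = q) → R ◁ tpowFam c ≫ u = 0) : u = 0 := by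
  have key : ∀ f ∈ AddSubgroup.closure
      {u | ∃ c : Fin n → (Y ⟶ Y), (∀ j, c j = p ∨ c j = q) ∧ tpowFam c = u},
      R ◁ f ≫ u = 0 := by
    intro f hf
    induction hf using AddSubgroup.closure_induction with
    | mem f hf =>
      obtain ⟨c, hc, rfl⟩ := hf
      exact hu c hc
    | zero => rw [whisker_zero, zero_comp]
    | add f g _ _ hf hg =>
      rw [MonoidalPreadditive.whiskerLeft_add, Preadditive.add_comp, hf, hg, add_zero]
    | neg f _ hf =>
      rw [← zero_sub, whisker_sub, whisker_zero, Preadditive.sub_comp, hf, zero_comp, sub_zero]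
  have := key _ (id_tpow_mem_closure h n)
  rwa [whiskerLeft_id, Category.id_comp] at this

end Additivity

/-! ### Operations of an algebra applied after a family of endomorphisms. -/

section Families

variable {A : Type u} [Category.{v} A] [Abelian A] [HasColimits A] [MonoidalCategory A]
  [SymmetricCategory A] [MonoidalClosed A] {P : SymmOperad A}

namespace Alg

/-- The `n`-ary operations of `E`, applied after a family of endomorphisms of the underlying
object. -/
def actFam (E : Alg P) {n : ℕ} (e : Fin n → (E.carrier ⟶ E.carrier)) :
    P.obj n ⊗ tpow E.carrier n ⟶ E.carrier :=
  P.obj n ◁ tpowFam e ≫ E.act n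

variable (E : Alg P)

theorem tpowFam_actFam {n : ℕ} (c e : Fin n → (E.carrier ⟶ E.carrier)) :
    P.obj n ◁ tpowFam c ≫ E.actFam e = E.actFam fun j => c j ≫ e j := by
  rw [actFam, actFam, ← tpowFam_comp, whiskerLeft_comp, Category.assoc]

theorem actFam_perm {n : ℕ} (σ : Equiv.Perm (Fin n)) (e : Fin n → (E.carrier ⟶ E.carrier)) :
    (P.map σ ⊗ₘ tpowPerm E.carrier σ) ≫ E.actFam e = E.actFam fun j => e (σ j) := by
  rw [actFam, actFam, ← Category.assoc, ← id_tensorHom, tensorHom_comp_tensorHom,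
    Category.comp_id, tpowPerm_fam, ← Category.id_comp (P.map σ), ← tensorHom_comp_tensorHom,
    Category.assoc, E.act_equivariant, id_tensorHom]

theorem actFam_eq_zero {n : ℕ} (e : Fin n → (E.carrier ⟶ E.carrier)) (a : Fin n) (h : e a = 0) :
    E.actFam e = 0 := by
  rw [actFam, tpowFam_eq_zero e a h, whisker_zero, zero_comp]

theorem actFam_sub {n : ℕ} (e f g : Fin n → (E.carrier ⟶ E.carrier)) (b : Fin n)
    (h : e b = f b - g b) (hf : ∀ j, j ≠ b → f j = e j) (hg : ∀ j, j ≠ b → g j = e j) :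
    E.actFam e = E.actFam f - E.actFam g := by
  rw [actFam, tpowFam_sub e f g b h hf hg, whisker_sub, Preadditive.sub_comp]; rfl

end Alg

end Families

/-! ### Moving a point and a subset of the inputs into standard position. -/

section Permutations

/-- The family with value `x` at the first position, `y` at the next `k` ones and `z` at the
last `j` ones. -/
def threeBlocks {α : Type*} (x y z : α) (k j : ℕ) : Fin (1 + k + j) → α :=
  Fin.append (Fin.append (fun _ : Fin 1 => x) fun _ : Fin k => y) fun _ : Fin j => z

theorem comp_threeBlocks {α β : Type*} (f : α → β) (x y z : α) (k j : ℕ) (i : Fin (1 + k + j)) :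
    f (threeBlocks x y z k j i) = threeBlocks (f x) (f y) (f z) k j i := by
  refine Fin.addCases (fun i => Fin.addCases (fun i => ?_) (fun i => ?_) i) (fun i => ?_) i <;>
    simp [threeBlocks]

/-- Any partition of a finite set into a point, a subset and the rest can be brought into the
standard position. -/
theorem exists_perm_threeBlocks {k j : ℕ} (a : Fin (1 + k + j)) (S : Finset (Fin (1 + k + j)))
    (ha : a ∉ S) (hS : S.card = k) :
    ∃ σ : Equiv.Perm (Fin (1 + k + j)), ∀ i, threeBlocks (0 : Fin 3) 1 2 k j (σ i) =
      if i = a then 0 else if i ∈ S then 1 else 2 := by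
  classical
  set f : Fin (1 + k + j) → Fin 3 := fun i => if i = a then 0 else if i ∈ S then 1 else 2 with hf
  set g : Fin (1 + k + j) → Fin 3 := threeBlocks (0 : Fin 3) 1 2 k j with hg
  have f0 : (Finset.univ.filter fun i => f i = 0).card = 1 := by
    rw [Finset.card_eq_one]
    refine ⟨a, ?_⟩
    ext i
    simp only [hf, Finset.mem_filter, Finset.mem_univ, true_and, Finset.mem_singleton]
    split_ifs <;> simp_all
  have f1 : (Finset.univ.filter fun i => f i = 1).card = k := by
    refine (congrArg Finset.card ?_).trans hS
    ext i
    simp only [hf, Finset.mem_filter, Finset.mem_univ, true_and]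
    split_ifs <;> simp_all
  have g0 : (Finset.univ.filter fun i => g i = 0).card = 1 := by
    rw [Finset.card_filter, Fin.sum_univ_add, Fin.sum_univ_add]
    simp [hg, threeBlocks]
  have g1 : (Finset.univ.filter fun i => g i = 1).card = k := by
    rw [Finset.card_filter, Fin.sum_univ_add, Fin.sum_univ_add]
    simp [hg, threeBlocks]
  -- The three fibres exhaust the set, so the size of the third one follows from the other two. Maps
  -- with equinumerous fibres differ by a permutation.
  have total : ∀ h : Fin (1 + k + j) → Fin 3,
      (Finset.univ.filter fun i => h i = 0).card + (Finset.univ.filter fun i => h i = 1).card +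
        (Finset.univ.filter fun i => h i = 2).card = 1 + k + j := by
    intro h
    have := Finset.card_eq_sum_card_fiberwise (f := h) (s := Finset.univ) (t := Finset.univ)
      (fun _ _ => Finset.mem_univ _)
    rw [Finset.card_univ, Fintype.card_fin, Fin.sum_univ_three] at this
    exact this.symm
  have tf := total f
  have tg := total g
  have hc : ∀ c : Fin 3, Fintype.card {i // f i = c} = Fintype.card {i // g i = c} := by
    intro c
    rw [Fintype.card_subtype, Fintype.card_subtype]
    fin_cases c
    · exact f0.trans g0.symm
    · exact f1.trans g1.symm
    · show (Finset.univ.filter fun i => f i = 2).card = (Finset.univ.filter fun i => g i = 2).card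
      omega
  exact ⟨Equiv.ofFiberEquiv fun c => Fintype.equivOfCardEq (hc c),
    fun i => Equiv.ofFiberEquiv_map _ i⟩

end Permutations

/-! ### Equivalence of the vanishing condition and the Peiffer identity for families. -/

section Criteria

variable {A : Type u} [Category.{v} A] [Abelian A] [HasColimits A] [MonoidalCategory A]
  [SymmetricCategory A] [MonoidalClosed A] {P : SymmOperad A}

namespace Alg

variable (E : Alg P)

/-- The vanishing of the operations on the images of `p` and `p - δ`. -/
def CatOneFam (p δ : E.carrier ⟶ E.carrier) : Prop :=
  ∀ m : ℕ, E.actFam (Fin.append (fun _ : Fin 1 => p)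
    (Fin.append (fun _ : Fin 1 => p - δ) fun _ : Fin m => 𝟙 E.carrier)) = 0

/-- The Peiffer identity for the endomorphisms `p` and `δ` and the complement `q` of `p`. -/
def PeifferFam (p δ q : E.carrier ⟶ E.carrier) : Prop :=
  ∀ k j : ℕ, 1 ≤ k → E.actFam (threeBlocks p p q k j) = E.actFam (threeBlocks p δ q k j)

variable {E} {p δ q : E.carrier ⟶ E.carrier}

/-- The vanishing family, permuted so that `p` sits in slot `a` and `p - δ` in slot `b`, is
precomposed with `e`. Slot `b` becomes `p ≫ (p - δ) = p - δ` and all other slots remain those of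
`e`, so multilinearity identifies the result with the difference of the two sides. -/
theorem CatOneFam.replace_one (hpp : p ≫ p = p) (hpδ : p ≫ δ = δ) (H : E.CatOneFam p δ) {n : ℕ}
    (e f : Fin n → (E.carrier ⟶ E.carrier)) (a b : Fin n) (hab : a ≠ b) (hea : e a = p)
    (heb : e b = p) (hfb : f b = δ) (hf : ∀ j, j ≠ b → f j = e j) : E.actFam e = E.actFam f := by
  obtain ⟨m, rfl⟩ : ∃ m, n = 1 + (1 + m) := by
    have ha := a.2
    have hb := b.2
    have : (a : ℕ) ≠ b := fun h => hab (Fin.ext h)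
    exact ⟨n - 2, by omega⟩
  set w : Fin (1 + (1 + m)) → (E.carrier ⟶ E.carrier) := Fin.append (fun _ : Fin 1 => p)
    (Fin.append (fun _ : Fin 1 => p - δ) fun _ : Fin m => 𝟙 E.carrier)
  let i₀ : Fin (1 + (1 + m)) := Fin.castAdd (1 + m) 0
  let i₁ : Fin (1 + (1 + m)) := Fin.natAdd 1 (Fin.castAdd m 0)
  have h01 : i₀ ≠ i₁ := fun h => by simpa [i₀, i₁] using congrArg Fin.val h
  have w0 : w i₀ = p := Fin.append_left _ _ _
  have w1 : w i₁ = p - δ := (Fin.append_right _ _ _).trans (Fin.append_left _ _ _)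
  have w2 : ∀ i, i ≠ i₀ → i ≠ i₁ → w i = 𝟙 _ := by
    refine fun i => Fin.addCases (fun i => ?_) (fun i => Fin.addCases (fun i => ?_)
      (fun i => ?_) i) i
    · intro h
      exact absurd (congrArg (Fin.castAdd (1 + m)) (Subsingleton.elim i 0)) h
    · intro _ h
      exact absurd (congrArg (fun i => Fin.natAdd 1 (Fin.castAdd m i)) (Subsingleton.elim i 0)) h
    · intro _ _
      exact (Fin.append_right _ _ _).trans (Fin.append_right _ _ _)
  -- The first swap brings `a` to `i₀`; the second brings the image of `b` to `i₁` and fixes `i₀`,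
  -- as neither of its points is `i₀`.
  obtain ⟨σ, hσa, hσb⟩ : ∃ σ : Equiv.Perm (Fin (1 + (1 + m))), σ a = i₀ ∧ σ b = i₁ := by
    refine ⟨(Equiv.swap a i₀).trans (Equiv.swap (Equiv.swap a i₀ b) i₁), ?_, ?_⟩
    · rw [Equiv.trans_apply, Equiv.swap_apply_left, Equiv.swap_apply_of_ne_of_ne _ h01]
      intro h
      refine hab ((Equiv.swap a i₀).injective ?_)
      rw [Equiv.swap_apply_left, ← h]
    · rw [Equiv.trans_apply, Equiv.swap_apply_left]
  have hg : E.actFam (fun j => e j ≫ w (σ j)) = 0 := by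
    rw [← E.tpowFam_actFam e fun j => w (σ j), ← E.actFam_perm, H m, comp_zero, comp_zero]
  rw [E.actFam_sub _ e f b, sub_eq_zero] at hg
  · exact hg
  · rw [hσb, w1, heb, hfb, Preadditive.comp_sub, hpp, hpδ]
  · intro j hj
    by_cases hja : j = a
    · rw [hja, hσa, w0, hea, hpp]
    · rw [w2 _ (fun h => hja (σ.injective (h.trans hσa.symm)))
        (fun h => hj (σ.injective (h.trans hσb.symm))), Category.comp_id]
  · intro j hj
    rw [hf j hj]
    by_cases hja : j = a
    · rw [hja, hσa, w0, hea, hpp]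
    · rw [w2 _ (fun h => hja (σ.injective (h.trans hσa.symm)))
        (fun h => hj (σ.injective (h.trans hσb.symm))), Category.comp_id]

/-- Induction on `S`. Slot `a` keeps its `p` throughout, so `replace_one` applies at every step. -/
theorem CatOneFam.replace (hpp : p ≫ p = p) (hpδ : p ≫ δ = δ) (H : E.CatOneFam p δ) {n : ℕ}
    (e : Fin n → (E.carrier ⟶ E.carrier)) (a : Fin n) (hea : e a = p) (S : Finset (Fin n))
    (haS : a ∉ S) (heS : ∀ j ∈ S, e j = p) (f : Fin n → (E.carrier ⟶ E.carrier))
    (hfS : ∀ j ∈ S, f j = δ) (hf : ∀ j, j ∉ S → f j = e j) : E.actFam e = E.actFam f := by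
  classical
  induction S using Finset.induction_on generalizing f with
  | empty => rw [show f = e from funext fun j => hf j (Finset.notMem_empty j)]
  | insert b S hb ih =>
    have hab : a ≠ b := fun h => haS (h ▸ Finset.mem_insert_self a S)
    -- The intermediate family has `δ` on `S` but still `p` at the new slot `b`.
    rw [ih (fun h => haS (Finset.mem_insert_of_mem h))
      (fun j hj => heS j (Finset.mem_insert_of_mem hj)) (Function.update f b p)
      (fun j hj => ?_) (fun j hj => ?_)]
    · refine H.replace_one hpp hpδ _ f a b hab ?_ (Function.update_self _ _ _)
        (hfS b (Finset.mem_insert_self b S)) (fun j hj => (Function.update_of_ne hj _ _).symm)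
      rw [Function.update_of_ne hab, hf a haS, hea]
    · have hjb : j ≠ b := fun h => hb (h ▸ hj)
      rw [Function.update_of_ne hjb, hfS j (Finset.mem_insert_of_mem hj)]
    · by_cases hjb : j = b
      · rw [hjb, Function.update_self, heS b (Finset.mem_insert_self b S)]
      · rw [Function.update_of_ne hjb]
        exact hf j fun h => (Finset.mem_insert.1 h).elim hjb hj

theorem CatOneFam.peiffer (hpp : p ≫ p = p) (hpδ : p ≫ δ = δ) (H : E.CatOneFam p δ)
    (q : E.carrier ⟶ E.carrier) : E.PeifferFam p δ q := by
  classical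
  intro k j _
  refine H.replace hpp hpδ _ (Fin.castAdd j (Fin.castAdd k 0)) (by simp [threeBlocks])
    (Finset.univ.image fun i : Fin k => Fin.castAdd j (Fin.natAdd 1 i)) ?_ ?_ _ ?_ ?_
  · simp only [Finset.mem_image, Finset.mem_univ, true_and, not_exists]
    intro i h
    simpa using congrArg Fin.val h
  · simp [threeBlocks]
  · simp [threeBlocks]
  · refine fun i => Fin.addCases (fun i => Fin.addCases (fun i => ?_) (fun i => ?_) i)
      (fun i => ?_) i
    · simp [threeBlocks]
    · simp [threeBlocks]
    · intro h
      exact absurd (Finset.mem_image_of_mem (fun i : Fin k => Fin.castAdd j (Fin.natAdd 1 i))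
        (Finset.mem_univ i)) h

/-- Equivariance extends the Peiffer identity from consecutive blocks to a distinguished slot `a`
and any set `S` of slots. -/
theorem PeifferFam.replace (H : E.PeifferFam p δ q) {n : ℕ}
    (e f : Fin n → (E.carrier ⟶ E.carrier)) (a : Fin n) (S : Finset (Fin n)) (haS : a ∉ S)
    (hea : e a = p) (hfa : f a = p) (heS : ∀ j ∈ S, e j = p) (hfS : ∀ j ∈ S, f j = δ)
    (he : ∀ j, j ≠ a → j ∉ S → e j = q) (hf : ∀ j, j ≠ a → j ∉ S → f j = q) :
    E.actFam e = E.actFam f := by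
  classical
  obtain ⟨k, hk⟩ : ∃ k, S.card = k := ⟨_, rfl⟩
  -- The Peiffer identity requires `k ≥ 1`; for empty `S` the two families are equal.
  obtain rfl | hk1 := Nat.eq_zero_or_pos k
  · rw [Finset.card_eq_zero] at hk
    subst hk
    congr 1
    funext j
    by_cases hja : j = a
    · rw [hja, hea, hfa]
    · rw [he j hja (Finset.notMem_empty j), hf j hja (Finset.notMem_empty j)]
  obtain ⟨j, rfl⟩ : ∃ j, n = 1 + k + j := by
    have := Finset.card_le_univ (insert a S)
    rw [Finset.card_insert_of_notMem haS, Fintype.card_fin] at this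
    exact ⟨n - (1 + k), by omega⟩
  obtain ⟨σ, hσ⟩ := exists_perm_threeBlocks a S haS hk
  have key : ∀ (y : E.carrier ⟶ E.carrier) (g : Fin (1 + k + j) → (E.carrier ⟶ E.carrier)),
      g a = p → (∀ j ∈ S, g j = y) → (∀ j, j ≠ a → j ∉ S → g j = q) →
      g = fun i => threeBlocks p y q k j (σ i) := by
    intro y g hga hgS hg
    funext i
    -- The labels `0, 1, 2` provided by the permutation are turned into the morphisms `p, y, q`.
    have := comp_threeBlocks (![p, y, q]) 0 1 2 k j (σ i)
    rw [hσ i] at this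
    refine Eq.trans ?_ this
    split_ifs with h1 h2
    · rw [h1, hga]; rfl
    · rw [hgS i h2]; rfl
    · rw [hg i h1 h2]; rfl
  rw [key p e hea heS he, key δ f hfa hfS hf, ← E.actFam_perm, ← E.actFam_perm, H k j hk1]

/-- After expansion by `1 = p + q`, a term that survives has `p` in slots `a` and `b`. It is the
difference of two values, with `p` and with `δ` in slot `b`. Peiffer reduces both to the family `g`,
where every `p` outside slot `a` has become `δ`. -/
theorem PeifferFam.catOne (hpq : p + q = 𝟙 E.carrier) (hpp : p ≫ p = p) (hqp : q ≫ p = 0)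
    (hpδ : p ≫ δ = δ) (hδq : δ ≫ q = δ) (H : E.PeifferFam p δ q) : E.CatOneFam p δ := by
  classical
  intro m
  set w : Fin (1 + (1 + m)) → (E.carrier ⟶ E.carrier) := Fin.append (fun _ : Fin 1 => p)
    (Fin.append (fun _ : Fin 1 => p - δ) fun _ : Fin m => 𝟙 E.carrier)
  let a : Fin (1 + (1 + m)) := Fin.castAdd (1 + m) 0
  let b : Fin (1 + (1 + m)) := Fin.natAdd 1 (Fin.castAdd m 0)
  have hab : a ≠ b := fun h => by simpa [a, b] using congrArg Fin.val h
  have wa : w a = p := Fin.append_left _ _ _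
  have wb : w b = p - δ := (Fin.append_right _ _ _).trans (Fin.append_left _ _ _)
  have w2 : ∀ i, i ≠ a → i ≠ b → w i = 𝟙 _ := by
    refine fun i => Fin.addCases (fun i => ?_) (fun i => Fin.addCases (fun i => ?_)
      (fun i => ?_) i) i
    · intro h
      exact absurd (congrArg (Fin.castAdd (1 + m)) (Subsingleton.elim i 0)) h
    · intro _ h
      exact absurd (congrArg (fun i => Fin.natAdd 1 (Fin.castAdd m i)) (Subsingleton.elim i 0)) h
    · intro _ _
      exact (Fin.append_right _ _ _).trans (Fin.append_right _ _ _)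
  have hqδ : q ≫ δ = 0 := by rw [← hpδ, ← Category.assoc, hqp, zero_comp]
  refine eq_zero_of_tpowFam_comp hpq _ fun c hc => ?_
  rw [E.tpowFam_actFam]
  obtain hca | hca := hc a
  swap
  · exact E.actFam_eq_zero _ a (by rw [wa, hca, hqp])
  obtain hcb | hcb := hc b
  swap
  · exact E.actFam_eq_zero _ b (by rw [wb, hcb, Preadditive.comp_sub, hqp, hqδ, sub_zero])
  set g : Fin (1 + (1 + m)) → (E.carrier ⟶ E.carrier) :=
    fun j => if j = a then p else if c j = p then δ else q with hg
  have hcq : ∀ j, c j ≠ p → c j = q := fun j hj => (hc j).resolve_left hj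
  have e1 : E.actFam c = E.actFam g := by
    refine H.replace _ _ a (Finset.univ.filter fun j => j ≠ a ∧ c j = p) (by simp) hca
      (by simp [hg]) (by simp) ?_ ?_ ?_
    · intro j hj
      simp only [Finset.mem_filter, Finset.mem_univ, true_and] at hj
      simp [hg, hj.1, hj.2]
    · intro j h1 h2
      simp only [Finset.mem_filter, Finset.mem_univ, true_and, not_and] at h2
      exact hcq j (h2 h1)
    · intro j h1 h2
      simp only [Finset.mem_filter, Finset.mem_univ, true_and, not_and] at h2
      simp [hg, h1, h2 h1]
  -- Peiffer cannot be applied directly with `δ` in slot `b`, so `q` is put there, which leaves that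
  -- slot outside the replaced set.
  have e2 : E.actFam (Function.update c b q) = E.actFam (Function.update g b q) := by
    refine H.replace _ _ a (Finset.univ.filter fun j => j ≠ a ∧ j ≠ b ∧ c j = p) (by simp)
      (by rw [Function.update_of_ne hab, hca])
      (by rw [Function.update_of_ne hab]; simp [hg]) ?_ ?_ ?_ ?_
    · intro j hj
      simp only [Finset.mem_filter, Finset.mem_univ, true_and] at hj
      rw [Function.update_of_ne hj.2.1, hj.2.2]
    · intro j hj
      simp only [Finset.mem_filter, Finset.mem_univ, true_and] at hj
      rw [Function.update_of_ne hj.2.1]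
      simp [hg, hj.1, hj.2.2]
    · intro j h1 h2
      simp only [Finset.mem_filter, Finset.mem_univ, true_and, not_and] at h2
      by_cases hjb : j = b
      · rw [hjb, Function.update_self]
      · rw [Function.update_of_ne hjb, hcq j (h2 h1 hjb)]
    · intro j h1 h2
      simp only [Finset.mem_filter, Finset.mem_univ, true_and, not_and] at h2
      by_cases hjb : j = b
      · rw [hjb, Function.update_self]
      · rw [Function.update_of_ne hjb]
        simp [hg, h1, h2 h1 hjb]
  -- Precomposing slot `b` with `δ` turns its `q` into `δ ≫ q = δ`. On the right this restores `g`,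
  -- whose entry at `b` is already `δ`.
  have e3 : E.actFam (Function.update c b δ) = E.actFam g := by
    have h := congrArg (fun u => P.obj _ ◁
      tpowFam (Function.update (fun _ => 𝟙 E.carrier) b δ) ≫ u) e2
    simp only [E.tpowFam_actFam] at h
    convert h using 2
    · funext j
      by_cases hjb : j = b
      · subst hjb; simp [hδq]
      · simp [Function.update_of_ne hjb]
    · funext j
      by_cases hjb : j = b
      · subst hjb; simp [hδq, hg, hcb, hab.symm]
      · simp [Function.update_of_ne hjb]
  rw [E.actFam_sub _ c (Function.update c b δ) b, e1, e3, sub_self]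
  · rw [wb, hcb, Function.update_self, Preadditive.comp_sub, hpp, hpδ]
  · intro j hj
    by_cases hja : j = a
    · rw [hja, wa, hca, hpp]
    · rw [w2 j hja hj, Category.comp_id]
  · intro j hj
    rw [Function.update_of_ne hj]
    by_cases hja : j = a
    · rw [hja, wa, hca, hpp]
    · rw [w2 j hja hj, Category.comp_id]

end Alg

end Criteria

/-! ### Translation of the crossed module and `Cat¹` conditions into families. -/

section Comparison

variable {A : Type u} [Category.{v} A] [MonoidalCategory A]

theorem blocks_join {Y Z : A} (x y z : Y ⟶ Z) (k j : ℕ) :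
    ((tpowCons Y k).hom ▷ tpow Y j ≫ (tpowJoin Y (1 + k) j).hom) ≫
        tpowFam (threeBlocks x y z k j) =
      ((x ⊗ₘ tpowMap y k) ⊗ₘ tpowMap z j) ≫
        (tpowCons Z k).hom ▷ tpow Z j ≫ (tpowJoin Z (1 + k) j).hom := by
  rw [threeBlocks, Category.assoc, tpowJoin_fam, ← Category.assoc, ← Category.assoc]
  congr 1
  rw [← tensorHom_id, ← tensorHom_id, tensorHom_comp_tensorHom, tensorHom_comp_tensorHom,
    tpowCons_fam, tpowFam_const, tpowFam_const, Category.id_comp, Category.comp_id]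

theorem cons_cons_fam {Y Z : A} (x y z : Y ⟶ Z) (m : ℕ) :
    (Y ◁ (tpowCons Y m).hom ≫ (tpowCons Y (1 + m)).hom) ≫
        tpowFam (Fin.append (fun _ : Fin 1 => x)
          (Fin.append (fun _ : Fin 1 => y) fun _ : Fin m => z)) =
      (x ⊗ₘ (y ⊗ₘ tpowMap z m)) ≫ Z ◁ (tpowCons Z m).hom ≫ (tpowCons Z (1 + m)).hom := by
  rw [Category.assoc, tpowCons_fam, ← Category.assoc, ← Category.assoc]
  congr 1
  rw [← id_tensorHom, ← id_tensorHom, tensorHom_comp_tensorHom, tensorHom_comp_tensorHom,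
    tpowCons_fam, tpowFam_const, Category.id_comp, Category.comp_id]

variable [Abelian A] [HasColimits A] [SymmetricCategory A] {P : SymmOperad A}

/-- Such `u` and `v` factor through the kernels, so the condition may be tested on arbitrary
morphisms killed by `s` and `t`. -/
theorem IsCatOne.act_eq_zero {G : ReflGraph P} (H : IsCatOne P G) {U V W : A}
    (u : U ⟶ G.E.carrier) (v : V ⟶ G.E.carrier) (m : ℕ) (w : W ⟶ tpow G.E.carrier m)
    (hu : u ≫ Alg.Hom.hom G.s = 0) (hv : v ≫ Alg.Hom.hom G.t = 0) :
    P.obj (1 + (1 + m)) ◁ ((u ⊗ₘ (v ⊗ₘ w)) ≫ G.E.carrier ◁ (tpowCons G.E.carrier m).hom ≫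
        (tpowCons G.E.carrier (1 + m)).hom) ≫ G.E.act (1 + (1 + m)) = 0 := by
  have e : (u ⊗ₘ (v ⊗ₘ w)) = (kernel.lift _ u hu ⊗ₘ (kernel.lift _ v hv ⊗ₘ w)) ≫
      (kernel.ι (Alg.Hom.hom G.s) ⊗ₘ (kernel.ι (Alg.Hom.hom G.t) ⊗ₘ 𝟙 _)) := by
    rw [tensorHom_comp_tensorHom, tensorHom_comp_tensorHom, kernel.lift_ι, kernel.lift_ι,
      Category.comp_id]
  rw [e, Category.assoc, whiskerLeft_comp, Category.assoc, H m, comp_zero]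

variable [MonoidalClosed A]

/-- The `Cat¹`-condition is invariant under isomorphisms of reflexive graphs. -/
theorem IsCatOne.of_iso {G G' : ReflGraph P} (φ : G ≅ G') (H : IsCatOne P G) : IsCatOne P G' := by
  intro m
  have hs := congrArg Alg.Hom.hom (ReflGraph.Hom.s_comm φ.inv)
  have ht := congrArg Alg.Hom.hom (ReflGraph.Hom.t_comm φ.inv)
  rw [Alg.comp_hom, Alg.comp_hom] at hs ht
  have hi : Alg.Hom.hom (ReflGraph.Hom.e φ.inv) ≫ Alg.Hom.hom (ReflGraph.Hom.e φ.hom) = 𝟙 _ :=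
    congrArg (fun h => Alg.Hom.hom (ReflGraph.Hom.e h)) φ.inv_hom_id
  have hm : Mono (Alg.Hom.hom (ReflGraph.Hom.e φ.inv)) :=
    (SplitMono.mk _ hi).mono
  rw [← cancel_mono (Alg.Hom.hom (ReflGraph.Hom.e φ.inv)), zero_comp, Category.assoc,
    Alg.Hom.comm, ← Category.assoc, ← whiskerLeft_comp, Category.assoc, ← tpowFam_const]
  have e : (fun _ : Fin (1 + (1 + m)) => Alg.Hom.hom (ReflGraph.Hom.e φ.inv)) =
      Fin.append (fun _ : Fin 1 => Alg.Hom.hom (ReflGraph.Hom.e φ.inv))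
        (Fin.append (fun _ : Fin 1 => Alg.Hom.hom (ReflGraph.Hom.e φ.inv))
          fun _ : Fin m => Alg.Hom.hom (ReflGraph.Hom.e φ.inv)) := by
    refine funext fun i => Fin.addCases (fun i => ?_)
      (fun i => Fin.addCases (fun i => ?_) (fun i => ?_) i) i <;> simp
  rw [e, cons_cons_fam, ← Category.assoc, tensorHom_comp_tensorHom, tensorHom_comp_tensorHom]
  refine H.act_eq_zero _ _ m _ ?_ ?_
  · rw [Category.assoc, ← hs, kernel.condition_assoc, zero_comp]
  · rw [Category.assoc, ← ht, kernel.condition_assoc, zero_comp]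

/-- The hypotheses make `p` and `p - δ` idempotents with images `ker s` and `ker t`. One direction
factors them through the kernels, the other uses that they fix the kernel inclusions; the
rebracketing is invertible. -/
theorem isCatOne_iff_catOneFam (G : ReflGraph P) {p δ : G.E.carrier ⟶ G.E.carrier}
    (hs : p ≫ Alg.Hom.hom G.s = 0) (ht : (p - δ) ≫ Alg.Hom.hom G.t = 0)
    (ks : ∀ {K : A} (k : K ⟶ G.E.carrier), k ≫ Alg.Hom.hom G.s = 0 → k ≫ p = k)
    (kt : ∀ {K : A} (k : K ⟶ G.E.carrier), k ≫ Alg.Hom.hom G.t = 0 → k ≫ (p - δ) = k) :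
    IsCatOne P G ↔ G.E.CatOneFam p δ := by
  have key : ∀ m, P.obj (1 + (1 + m)) ◁ (G.E.carrier ◁ (tpowCons G.E.carrier m).hom ≫
      (tpowCons G.E.carrier (1 + m)).hom) ≫
      G.E.actFam (Fin.append (fun _ : Fin 1 => p)
        (Fin.append (fun _ : Fin 1 => p - δ) fun _ : Fin m => 𝟙 _)) =
      P.obj (1 + (1 + m)) ◁ ((p ⊗ₘ ((p - δ) ⊗ₘ 𝟙 _)) ≫
        G.E.carrier ◁ (tpowCons G.E.carrier m).hom ≫ (tpowCons G.E.carrier (1 + m)).hom) ≫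
        G.E.act (1 + (1 + m)) := by
    intro m
    rw [Alg.actFam, ← Category.assoc, ← whiskerLeft_comp, cons_cons_fam, tpowMap_id]
  constructor
  · intro H m
    rw [← cancel_epi (P.obj (1 + (1 + m)) ◁ (G.E.carrier ◁ (tpowCons G.E.carrier m).hom ≫
      (tpowCons G.E.carrier (1 + m)).hom)), key, comp_zero]
    exact IsCatOne.act_eq_zero H _ _ m (𝟙 _) hs ht
  · intro H m
    have e : (kernel.ι (Alg.Hom.hom G.s) ⊗ₘ (kernel.ι (Alg.Hom.hom G.t) ⊗ₘ
        𝟙 (tpow G.E.carrier m))) ≫ (p ⊗ₘ ((p - δ) ⊗ₘ 𝟙 _)) =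
        kernel.ι (Alg.Hom.hom G.s) ⊗ₘ (kernel.ι (Alg.Hom.hom G.t) ⊗ₘ 𝟙 _) := by
      rw [tensorHom_comp_tensorHom, tensorHom_comp_tensorHom, ks _ (kernel.condition _),
        kt _ (kernel.condition _), Category.comp_id]
    rw [← e, Category.assoc, whiskerLeft_comp, Category.assoc, ← key, H m, comp_zero, comp_zero]

namespace PXMod

variable (M : PXMod P)

/-- The projection of `X ⊕ B` onto `X`. -/
abbrev projX : M.X.carrier ⊞ M.B.carrier ⟶ M.X.carrier ⊞ M.B.carrier := biprod.fst ≫ biprod.inl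

/-- The endomorphism `(x, b) ↦ (0, d x)` of `X ⊕ B`. -/
abbrev boundary : M.X.carrier ⊞ M.B.carrier ⟶ M.X.carrier ⊞ M.B.carrier :=
  biprod.fst ≫ Alg.Hom.hom M.d ≫ biprod.inr

/-- The projection of `X ⊕ B` onto `B`. -/
abbrev projB : M.X.carrier ⊞ M.B.carrier ⟶ M.X.carrier ⊞ M.B.carrier := biprod.snd ≫ biprod.inr

theorem isCatOne_iff :
    IsCatOne P ((toReflGraph P).obj M) ↔
      (semidirect M.action).CatOneFam M.projX M.boundary := by
  have hs : (biprod.fst ≫ biprod.inl : M.X.carrier ⊞ M.B.carrier ⟶ _) ≫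
      (biprod.snd : M.X.carrier ⊞ M.B.carrier ⟶ _) = 0 := by simp
  have ht : (M.projX - M.boundary) ≫ biprod.desc (Alg.Hom.hom M.d) (𝟙 M.B.carrier) = 0 := by
    simp
  have ks : ∀ {K : A} (k : K ⟶ M.X.carrier ⊞ M.B.carrier), k ≫ biprod.snd = 0 →
      k ≫ M.projX = k := by
    intro K k h
    apply biprod.hom_ext <;> simp [h]
  -- An element `(x, b)` of `ker t` satisfies `b = -d x`, and `p - δ` sends `(x, b)` to `(x, -d x)`.
  have kt : ∀ {K : A} (k : K ⟶ M.X.carrier ⊞ M.B.carrier),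
      k ≫ biprod.desc (Alg.Hom.hom M.d) (𝟙 M.B.carrier) = 0 →
      k ≫ (M.projX - M.boundary) = k := by
    intro K k h
    rw [biprod.desc_eq, Preadditive.comp_add, Category.comp_id] at h
    apply biprod.hom_ext
    · simp
    · simpa [neg_eq_iff_add_eq_zero] using h
  exact isCatOne_iff_catOneFam _ hs ht ks kt

/-- `X` is an ideal of `X ⋊ B`: the `B`-component of an operation depends only on the `B`-components
of its inputs, and here one of them is zero. -/
theorem sumAct_snd_eq_zero {n : ℕ}
    (e : Fin n → (M.X.carrier ⊞ M.B.carrier ⟶ M.X.carrier ⊞ M.B.carrier)) (a : Fin n)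
    (h : e a ≫ biprod.snd = 0) : (P.obj n ◁ tpowFam e ≫ sumAct M.B M.action.hom n) ≫ biprod.snd = 0 := by
  rw [sumAct, Category.assoc, biprod.lift_snd, ← Category.assoc, ← whiskerLeft_comp,
    ← tpowFam_const, tpowFam_comp, tpowFam_eq_zero _ a h, whisker_zero, zero_comp]

/-- The Peiffer identity lives on `P ⊗ X^i ⊗ B^(n-i)` with values in `X`. Precomposing with the
split epimorphism from `P ⊗ (X ⊕ B)^n` loses nothing, nor does passing from `X ⊕ B` to its
`X`-component, since the `B`-component is zero. -/
theorem isCrossed_iff :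
    IsCrossed P M ↔
      (semidirect M.action).PeifferFam M.projX M.boundary M.projB := by
  set Y := M.X.carrier ⊞ M.B.carrier
  let ι₁ : M.X.carrier ⟶ Y := biprod.inl
  let ι₂ : M.B.carrier ⟶ Y := biprod.inr
  let π₁ : Y ⟶ M.X.carrier := biprod.fst
  let π₂ : Y ⟶ M.B.carrier := biprod.snd
  let J : ∀ k j, (Y ⊗ tpow Y k) ⊗ tpow Y j ⟶ tpow Y (1 + k + j) := fun k j =>
    (tpowCons Y k).hom ▷ tpow Y j ≫ (tpowJoin Y (1 + k) j).hom
  -- Both sides of the Peiffer identity are values of `L`: for `y = ι₁` and for `y = d ≫ ι₂`.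
  let L : ∀ k j, (M.X.carrier ⟶ Y) → (P.obj (1 + k + j) ⊗
      ((M.X.carrier ⊗ tpow M.X.carrier k) ⊗ tpow M.B.carrier j) ⟶ M.X.carrier) :=
    fun k j y => P.obj (1 + k + j) ◁ (((ι₁ ⊗ₘ tpowMap y k) ⊗ₘ tpowMap ι₂ j) ≫ J k j) ≫
      relIncl P M.B.carrier M.X.carrier (1 + k + j) ≫ M.action.hom
  let F : ∀ {n : ℕ}, (Fin n → (Y ⟶ Y)) → (P.obj n ⊗ tpow Y n ⟶ Y) := fun e =>
    P.obj _ ◁ tpowFam e ≫ sumAct M.B M.action.hom _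
  have hL : ∀ k j y, P.obj (1 + k + j) ◁ ((π₁ ⊗ₘ tpowMap π₁ k) ⊗ₘ tpowMap π₂ j) ≫ L k j y =
      P.obj (1 + k + j) ◁ J k j ≫
        F (threeBlocks M.projX (π₁ ≫ y) M.projB k j) ≫ π₁ := by
    intro k j y
    have h1 : sumAct M.B M.action.hom (1 + k + j) ≫ π₁ =
      relIncl P M.B.carrier M.X.carrier (1 + k + j) ≫ M.action.hom := biprod.lift_fst _ _
    have hb : ((π₁ ⊗ₘ tpowMap π₁ k) ⊗ₘ tpowMap π₂ j) ≫
        ((ι₁ ⊗ₘ tpowMap y k) ⊗ₘ tpowMap ι₂ j) ≫ J k j =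
        J k j ≫ tpowFam (threeBlocks M.projX (π₁ ≫ y) M.projB k j) := by
      rw [tensorHom_comp_tensorHom_assoc, tensorHom_comp_tensorHom, ← tpowMap_comp,
        ← tpowMap_comp]
      exact (blocks_join _ _ _ k j).symm
    simp only [L, F]
    rw [← h1, ← Category.assoc, ← whiskerLeft_comp, hb, whiskerLeft_comp, Category.assoc,
      Category.assoc]
  have hiff : ∀ k j, L k j ι₁ = L k j (Alg.Hom.hom M.d ≫ ι₂) ↔
      F (threeBlocks M.projX M.projX M.projB k j) =
      F (threeBlocks M.projX M.boundary M.projB k j) := by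
    intro k j
    have hR : ((ι₁ ⊗ₘ tpowMap ι₁ k) ⊗ₘ tpowMap ι₂ j) ≫
        ((π₁ ⊗ₘ tpowMap π₁ k) ⊗ₘ tpowMap π₂ j) = 𝟙 _ := by
      rw [tensorHom_comp_tensorHom, tensorHom_comp_tensorHom, ← tpowMap_comp, ← tpowMap_comp]
      simp only [ι₁, ι₂, π₁, π₂, biprod.inl_fst, biprod.inr_snd, tpowMap_id, id_tensorHom_id]
    have hE : Epi (P.obj (1 + k + j) ◁ ((π₁ ⊗ₘ tpowMap π₁ k) ⊗ₘ tpowMap π₂ j)) :=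
      (SplitEpi.mk (P.obj (1 + k + j) ◁ ((ι₁ ⊗ₘ tpowMap ι₁ k) ⊗ₘ tpowMap ι₂ j)) (by
        rw [← whiskerLeft_comp, hR, whiskerLeft_id])).epi
    have hJ : Epi (P.obj (1 + k + j) ◁ J k j) := by
      simp only [J]
      infer_instance
    rw [← cancel_epi (P.obj (1 + k + j) ◁ ((π₁ ⊗ₘ tpowMap π₁ k) ⊗ₘ tpowMap π₂ j)), hL, hL,
      cancel_epi]
    have h0 : ∀ y z : Y ⟶ Y, F (threeBlocks M.projX y z k j) ≫
        biprod.snd = 0 := fun y z =>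
      M.sumAct_snd_eq_zero _ (Fin.castAdd j (Fin.castAdd k 0)) (by simp [threeBlocks])
    constructor
    · intro h
      exact biprod.hom_ext _ _ h ((h0 _ _).trans (h0 _ _).symm)
    · intro h
      exact congrArg (· ≫ π₁) h
  refine forall_congr' fun k => forall_congr' fun j => imp_congr_right fun _ =>
    Iff.trans ?_ (hiff k j)
  have e : (((𝟙 M.X.carrier) ⊗ₘ tpowMap (Alg.Hom.hom M.d) k) ⊗ₘ 𝟙 (tpow M.B.carrier j)) ≫
      ((ι₁ ⊗ₘ tpowMap ι₂ k) ⊗ₘ tpowMap ι₂ j) =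
      ((ι₁ ⊗ₘ tpowMap (Alg.Hom.hom M.d ≫ ι₂) k) ⊗ₘ tpowMap ι₂ j) := by
    rw [tensorHom_comp_tensorHom, tensorHom_comp_tensorHom, tpowMap_comp, Category.id_comp,
      Category.id_comp]
  simp only [L, J, ← e, Category.assoc]
  exact Iff.rfl

/-- A precrossed module is crossed if and only if its reflexive graph is a `Cat¹`-algebra. -/
theorem isCrossed_iff_isCatOne : IsCrossed P M ↔ IsCatOne P ((toReflGraph P).obj M) := by
  have hpp : M.projX ≫ M.projX = M.projX := by simp
  have hqp : M.projB ≫ M.projX = 0 := by simp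
  have hpδ : M.projX ≫ M.boundary = M.boundary := by simp
  have hδq : M.boundary ≫ M.projB = M.boundary := by simp
  rw [isCrossed_iff, isCatOne_iff]
  exact ⟨fun H => H.catOne biprod.total hpp hqp hpδ hδq,
    fun H => H.peiffer hpp hpδ _⟩

end PXMod

end Comparison

/-! ### The precrossed module of a reflexive graph and the equivalence. -/

section Reduced

variable {A : Type u} [Category.{v} A] [Abelian A] [HasColimits A] [MonoidalCategory A]
  [SymmetricCategory A] [MonoidalClosed A] {P : SymmOperad A}

/-- Tensoring with `P.obj n` is a left adjoint, so it preserves the epimorphism onto the quotient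
power. -/
theorem relSchur_hom_ext {B X W : A} {g h : relSchur P B X ⟶ W}
    (w : ∀ n, relIncl P B X n ≫ g = relIncl P B X n ≫ h) : g = h :=
  coinvSum_hom_ext fun n => by
    have hp : Epi (relPowProj B X n) := inferInstanceAs (Epi (cokernel.π _))
    have he : Epi (P.obj n ◁ relPowProj B X n) :=
      inferInstanceAs (Epi ((tensorLeft (P.obj n)).map (relPowProj B X n)))
    have := w n
    rw [relIncl, Category.assoc, Category.assoc] at this
    exact (cancel_epi _).1 this

/-- The structure of an algebra on a subobject which is closed under the operations. -/
def Alg.ofMono (E : Alg P) {X : A} (k : X ⟶ E.carrier) [Mono k]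
    (act : ∀ n, P.obj n ⊗ tpow X n ⟶ X)
    (hact : ∀ n, act n ≫ k = P.obj n ◁ tpowMap k n ≫ E.act n) : Alg P where
  carrier := X
  act := act
  act_equivariant {n} σ := by
    rw [← cancel_mono k, Category.assoc, hact, ← Category.assoc,
      tensor_equivariant (tpowPerm_naturality k σ), Category.assoc, E.act_equivariant]
  act_unit := by
    rw [← cancel_mono k, Category.assoc, hact, ← Category.assoc, ← unitInsert_naturality,
      Category.assoc, E.act_unit, Category.comp_id, Category.id_comp]
  act_comp a b n := by
    rw [← cancel_mono k, Category.assoc, Category.assoc, hact, hact,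
      ← Category.assoc (plug _ _ _ _ _), plug_naturality P k act E.act hact, Category.assoc,
      ← E.act_comp, ← Category.assoc, ← Category.assoc]
    congr 1
    rw [← id_tensorHom, ← id_tensorHom, tensorHom_comp_tensorHom, tensorHom_comp_tensorHom,
      tpowJoinThree_naturality, Category.id_comp, Category.comp_id]

/-- The case `n = 0` is where `P₀ = 0` is needed: the zeroth tensor power of the zero morphism is an
identity. -/
theorem SymmOperad.IsReduced.whisker_tpowMap_zero (hP : P.IsReduced) (Y Z : A) :
    ∀ n, P.obj n ◁ tpowMap (0 : Y ⟶ Z) n = 0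
  | 0 => by
      have h : 𝟙 (P.obj 0) = 0 := hP.isZero_obj_zero.eq_of_src _ _
      rw [← id_tensorHom, h, MonoidalPreadditive.zero_tensor]
  | n + 1 => by
      rw [← tpowFam_const, tpowFam_eq_zero _ (Fin.last n) rfl, whisker_zero]

namespace ReflGraph

variable (G : ReflGraph P)

/-- The kernel of the source morphism. -/
abbrev ker : A := kernel (Alg.Hom.hom G.s)

/-- The inclusion of the kernel of the source morphism. -/
abbrev kerι : G.ker ⟶ G.E.carrier := kernel.ι (Alg.Hom.hom G.s)

theorem i_s_hom : Alg.Hom.hom G.i ≫ Alg.Hom.hom G.s = 𝟙 _ := by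
  rw [← Alg.comp_hom, G.i_s, Alg.id_hom]

theorem i_t_hom : Alg.Hom.hom G.i ≫ Alg.Hom.hom G.t = 𝟙 _ := by
  rw [← Alg.comp_hom, G.i_t, Alg.id_hom]

/-- The projection of `E` onto the kernel of `s` along the image of `i`. -/
def kerπ : G.E.carrier ⟶ G.ker :=
  kernel.lift _ (𝟙 _ - Alg.Hom.hom G.s ≫ Alg.Hom.hom G.i) (by
    rw [Preadditive.sub_comp, Category.assoc, i_s_hom, Category.id_comp, Category.comp_id,
      sub_self])

theorem kerπ_ι : G.kerπ ≫ G.kerι = 𝟙 _ - Alg.Hom.hom G.s ≫ Alg.Hom.hom G.i :=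
  kernel.lift_ι _ _ _

theorem kerι_π : G.kerι ≫ G.kerπ = 𝟙 _ := by
  rw [← cancel_mono G.kerι, Category.assoc, kerπ_ι, Preadditive.comp_sub,
    kernel.condition_assoc, zero_comp, sub_zero, Category.comp_id, Category.id_comp]

theorem i_kerπ : Alg.Hom.hom G.i ≫ G.kerπ = 0 := by
  rw [← cancel_mono G.kerι, Category.assoc, kerπ_ι, Preadditive.comp_sub, ← Category.assoc,
    i_s_hom, Category.id_comp, Category.comp_id, sub_self, zero_comp]

/-- The morphism `ker s ⊕ B ⟶ E`. -/
def fromSum : G.ker ⊞ G.B.carrier ⟶ G.E.carrier := biprod.desc G.kerι (Alg.Hom.hom G.i)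

/-- The morphism `E ⟶ ker s ⊕ B`. -/
def toSum : G.E.carrier ⟶ G.ker ⊞ G.B.carrier := biprod.lift G.kerπ (Alg.Hom.hom G.s)

theorem toSum_fromSum : G.toSum ≫ G.fromSum = 𝟙 _ := by
  rw [toSum, fromSum, biprod.lift_desc, kerπ_ι, sub_add_cancel]

theorem fromSum_s : G.fromSum ≫ Alg.Hom.hom G.s = biprod.snd := by
  apply biprod.hom_ext' <;> simp [fromSum, i_s_hom]

theorem fromSum_t : G.fromSum ≫ Alg.Hom.hom G.t =
    biprod.desc (G.kerι ≫ Alg.Hom.hom G.t) (𝟙 _) := by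
  apply biprod.hom_ext' <;> simp [fromSum, i_t_hom]

theorem fromSum_kerπ : G.fromSum ≫ G.kerπ = biprod.fst := by
  apply biprod.hom_ext' <;> simp [fromSum, kerι_π, i_kerπ]

theorem fromSum_toSum : G.fromSum ≫ G.toSum = 𝟙 _ := by
  apply biprod.hom_ext <;> simp [toSum, fromSum_s, fromSum_kerπ]

/-- The operations on the kernel of the source morphism. -/
def kerAct (n : ℕ) : P.obj n ⊗ tpow G.ker n ⟶ G.ker :=
  P.obj n ◁ tpowMap G.kerι n ≫ G.E.act n ≫ G.kerπ

/-- The kernel is closed under the operations: `s` sends them to operations of `B` on zero inputs,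
which vanish for a reduced operad even in arity `0`. -/
theorem kerAct_ι (hP : P.IsReduced) (n : ℕ) : G.kerAct n ≫ G.kerι = P.obj n ◁ tpowMap G.kerι n ≫ G.E.act n := by
  have h : P.obj n ◁ tpowMap G.kerι n ≫ G.E.act n ≫ Alg.Hom.hom G.s = 0 := by
    rw [Alg.Hom.comm, ← Category.assoc, ← whiskerLeft_comp, ← tpowMap_comp, kernel.condition,
      hP.whisker_tpowMap_zero, zero_comp]
  rw [kerAct, Category.assoc, Category.assoc, kerπ_ι, Preadditive.comp_sub, Preadditive.comp_sub,
    Category.comp_id, reassoc_of% h, zero_comp, sub_zero]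

variable (hP : P.IsReduced)

/-- The kernel of the source morphism as an algebra. -/
def kerAlg : Alg P := G.E.ofMono G.kerι G.kerAct (G.kerAct_ι hP)

/-- The morphism `P ∘ (B | ker s) ⟶ P(ker s ⊕ B) ⟶ P(E) ⟶ E ⟶ ker s`. -/
def kerActionHom : relSchur P G.B.carrier G.ker ⟶ G.ker :=
  relToSchur P G.B.carrier G.ker ≫ schurMap P G.fromSum ≫ G.E.str ≫ G.kerπ

/-- `relToSchur` subtracts the term with all inputs projected to `B`. That term lies in the image of
the algebra morphism `i`, which `kerπ` kills. -/
theorem relIncl_kerActionHom (n : ℕ) : relIncl P G.B.carrier G.ker n ≫ G.kerActionHom =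
    P.obj n ◁ tpowMap G.fromSum n ≫ G.E.act n ≫ G.kerπ := by
  have h : P.obj n ◁ tpowMap ((biprod.snd : G.ker ⊞ G.B.carrier ⟶ _) ≫ biprod.inr) n ≫
      P.obj n ◁ tpowMap G.fromSum n ≫ G.E.act n ≫ G.kerπ = 0 := by
    have e : ((biprod.snd : G.ker ⊞ G.B.carrier ⟶ _) ≫ biprod.inr) ≫ G.fromSum = biprod.snd ≫ Alg.Hom.hom G.i := by
      simp [fromSum]
    rw [← Category.assoc, ← whiskerLeft_comp, ← tpowMap_comp, e, tpowMap_comp, whiskerLeft_comp,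
      Category.assoc, ← Category.assoc (_ ◁ tpowMap (Alg.Hom.hom G.i) n), ← Alg.Hom.comm,
      Category.assoc, i_kerπ, comp_zero, comp_zero]
  rw [kerActionHom, ← Category.assoc, relIncl_toSchur, Category.assoc,
    ← Category.assoc (schurIncl _ _ _), schurIncl_map, Category.assoc,
    ← Category.assoc (schurIncl _ _ _), Alg.schurIncl_str, whisker_sub, Preadditive.sub_comp, h,
    sub_zero, whiskerLeft_id, Category.id_comp]

/-- The semidirect structure is that of `E` transported along `E ≅ ker s ⊕ B`; associativity of the
action and the comparison isomorphism rest on this. -/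
theorem sumAct_kerActionHom (n : ℕ) :
    sumAct G.B G.kerActionHom n = P.obj n ◁ tpowMap G.fromSum n ≫ G.E.act n ≫ G.toSum := by
  apply biprod.hom_ext
  · rw [sumAct, biprod.lift_fst, relIncl_kerActionHom, Category.assoc, Category.assoc, toSum,
      biprod.lift_fst]
  · rw [sumAct, biprod.lift_snd, Category.assoc, Category.assoc, toSum, biprod.lift_snd,
      Alg.Hom.comm, ← Category.assoc, ← whiskerLeft_comp, ← tpowMap_comp, fromSum_s]

theorem sumAct_fromSum (n : ℕ) :
    sumAct G.B G.kerActionHom n ≫ G.fromSum = P.obj n ◁ tpowMap G.fromSum n ≫ G.E.act n := by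
  rw [sumAct_kerActionHom, Category.assoc, Category.assoc, toSum_fromSum, Category.comp_id]

/-- The action of `B` on the kernel of the source morphism. -/
def kerAction : InternalAction G.B (G.kerAlg hP) where
  hom := G.kerActionHom
  triangle := coinvSum_hom_ext fun n => by
    change schurIncl P G.ker n ≫ _ = schurIncl P (G.kerAlg hP).carrier n ≫ _
    rw [Alg.schurIncl_str]
    change schurIncl P G.ker n ≫ schurToRel P G.B.carrier G.ker ≫ G.kerActionHom = G.kerAct n
    rw [← Category.assoc, schurIncl_toRel, Category.assoc, relIncl_kerActionHom, ← Category.assoc, ← whiskerLeft_comp,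
      ← tpowMap_comp, fromSum, biprod.inl_desc, kerAct]
  assoc a b n := by
    change (P.comp a b n ⊗ₘ (tpowJoinThree (G.ker ⊞ G.B.carrier) a n b).hom) ≫
        relIncl P G.B.carrier G.ker (a + n + b) ≫ G.kerActionHom =
      plug P (sumAct G.B G.kerActionHom) a b n ≫
        relIncl P G.B.carrier G.ker (a + 1 + b) ≫ G.kerActionHom
    rw [relIncl_kerActionHom, relIncl_kerActionHom, ← Category.assoc (plug _ _ _ _ _),
      plug_naturality P _ _ G.E.act G.sumAct_fromSum, Category.assoc,
      ← Category.assoc (plug _ _ _ _ _), ← G.E.act_comp, Category.assoc, ← Category.assoc,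
      ← Category.assoc (_ ◁ _)]
    congr 1
    rw [← id_tensorHom, ← id_tensorHom, tensorHom_comp_tensorHom, tensorHom_comp_tensorHom,
      tpowJoinThree_naturality, Category.id_comp, Category.comp_id]

/-- The precrossed module of a reflexive graph. -/
def toPXMod : PXMod P where
  B := G.B
  X := G.kerAlg hP
  action := G.kerAction hP
  d :=
    { hom := G.kerι ≫ Alg.Hom.hom G.t
      comm := fun n => by
        change G.kerAct n ≫ G.kerι ≫ Alg.Hom.hom G.t = _
        rw [← Category.assoc, kerAct_ι _ hP, Category.assoc, Alg.Hom.comm, ← Category.assoc,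
          ← whiskerLeft_comp, ← tpowMap_comp]
        rfl }
  equivariant := relSchur_hom_ext fun n => by
    have e : biprod.map (G.kerι ≫ Alg.Hom.hom G.t) (𝟙 G.B.carrier) ≫
        biprod.desc (𝟙 _) (𝟙 _) = G.fromSum ≫ Alg.Hom.hom G.t := by
      rw [fromSum_t]
      apply biprod.hom_ext' <;> simp
    have hr : relIncl P G.B.carrier G.ker n ≫
        relMap P (𝟙 G.B.carrier) (G.kerι ≫ Alg.Hom.hom G.t) ≫ selfAction G.B =
        P.obj n ◁ tpowMap (G.fromSum ≫ Alg.Hom.hom G.t) n ≫ G.B.act n -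
          P.obj n ◁ tpowMap biprod.snd n ≫ G.B.act n := by
      rw [← Category.assoc, relIncl_map, Category.assoc, relIncl_selfAction,
        Preadditive.comp_sub, ← Category.assoc, ← Category.assoc, ← whiskerLeft_comp,
        ← whiskerLeft_comp, ← tpowMap_comp, ← tpowMap_comp, e, biprod.map_snd, Category.comp_id]
    -- Projecting to `ker s` and then applying `t` is `t - s`, because `i ≫ t = 𝟙`. The self-action
    -- of `B` yields the same difference in `hr`.
    have hl : relIncl P G.B.carrier G.ker n ≫ G.kerActionHom ≫ G.kerι ≫ Alg.Hom.hom G.t =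
        P.obj n ◁ tpowMap (G.fromSum ≫ Alg.Hom.hom G.t) n ≫ G.B.act n -
          P.obj n ◁ tpowMap biprod.snd n ≫ G.B.act n := by
      rw [← Category.assoc, relIncl_kerActionHom, Category.assoc, Category.assoc,
        ← Category.assoc G.kerπ, kerπ_ι, Preadditive.sub_comp, Category.id_comp, Category.assoc,
        i_t_hom, Category.comp_id, Preadditive.comp_sub, Preadditive.comp_sub, Alg.Hom.comm,
        Alg.Hom.comm, ← Category.assoc, ← Category.assoc, ← whiskerLeft_comp,
        ← whiskerLeft_comp, ← tpowMap_comp, ← tpowMap_comp, fromSum_s]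
    exact hl.trans hr.symm

/-- A reflexive graph is isomorphic to the one of its precrossed module. -/
def toPXModIso : (PXMod.toReflGraph P).obj (G.toPXMod hP) ≅ G where
  hom :=
    { e :=
        { hom := G.fromSum
          comm := G.sumAct_fromSum }
      b := 𝟙 G.B
      s_comm := Alg.hom_ext ((Category.comp_id _).trans G.fromSum_s.symm)
      t_comm := Alg.hom_ext ((Category.comp_id _).trans G.fromSum_t.symm)
      i_comm := Alg.hom_ext ((biprod.inr_desc _ _).trans (Category.id_comp _).symm) }
  inv :=
    { e :=
        { hom := G.toSum
          comm := fun n => by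
            change _ = P.obj n ◁ tpowMap G.toSum n ≫ sumAct G.B G.kerActionHom n
            rw [sumAct_kerActionHom, ← Category.assoc (_ ◁ _), ← whiskerLeft_comp,
              ← tpowMap_comp, toSum_fromSum, tpowMap_id, whiskerLeft_id, Category.id_comp]
            rfl }
      b := 𝟙 G.B
      s_comm := Alg.hom_ext ((Category.comp_id _).trans (biprod.lift_snd _ _).symm)
      t_comm := Alg.hom_ext (by
        change Alg.Hom.hom G.t ≫ 𝟙 _ =
          G.toSum ≫ biprod.desc (G.kerι ≫ Alg.Hom.hom G.t) (𝟙 _)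
        rw [← fromSum_t, ← Category.assoc, toSum_fromSum, Category.id_comp, Category.comp_id])
      i_comm := Alg.hom_ext (by
        change Alg.Hom.hom G.i ≫ G.toSum = 𝟙 _ ≫ biprod.inr
        apply biprod.hom_ext <;> simp [toSum, i_s_hom, i_kerπ]) }
  hom_inv_id := ReflGraph.Hom.ext (Alg.hom_ext G.fromSum_toSum) (Category.comp_id _)
  inv_hom_id := ReflGraph.Hom.ext (Alg.hom_ext G.toSum_fromSum) (Category.comp_id _)

end ReflGraph

namespace PXMod

theorem toReflGraph_faithful : (toReflGraph P).Faithful where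
  map_injective {M N h k} w := by
    refine Hom.ext (congrArg ReflGraph.Hom.b w) (Alg.hom_ext ?_)
    have e : biprod.map (Alg.Hom.hom (Hom.f h)) (Alg.Hom.hom (Hom.g h)) =
        biprod.map (Alg.Hom.hom (Hom.f k)) (Alg.Hom.hom (Hom.g k)) :=
      congrArg (fun φ => Alg.Hom.hom (ReflGraph.Hom.e φ)) w
    simpa using congrArg (fun φ => biprod.inl ≫ φ ≫ biprod.fst) e

/-- Commutation with `s` and `i` forces `e = f ⊕ g`. Compatibility with the actions is then the
first component of `e` being an algebra morphism, and compatibility with `d` is commutation with `t`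
restricted to `X`. -/
theorem toReflGraph_full : (toReflGraph P).Full where
  map_surjective {M N} φ := by
    let e : M.X.carrier ⊞ M.B.carrier ⟶ N.X.carrier ⊞ N.B.carrier :=
      Alg.Hom.hom (ReflGraph.Hom.e φ)
    let g : M.B ⟶ N.B := ReflGraph.Hom.b φ
    let f : M.X.carrier ⟶ N.X.carrier := biprod.inl ≫ e ≫ biprod.fst
    have hs : biprod.snd ≫ Alg.Hom.hom g = e ≫ biprod.snd :=
      congrArg Alg.Hom.hom (ReflGraph.Hom.s_comm φ)
    have ht : biprod.desc (Alg.Hom.hom M.d) (𝟙 _) ≫ Alg.Hom.hom g =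
        e ≫ biprod.desc (Alg.Hom.hom N.d) (𝟙 _) :=
      congrArg Alg.Hom.hom (ReflGraph.Hom.t_comm φ)
    have hi : biprod.inr ≫ e = Alg.Hom.hom g ≫ biprod.inr :=
      congrArg Alg.Hom.hom (ReflGraph.Hom.i_comm φ)
    have he : e = biprod.map f (Alg.Hom.hom g) := by
      apply biprod.hom_ext'
      · apply biprod.hom_ext
        · simp [f]
        · rw [Category.assoc, ← hs]; simp
      · rw [hi, biprod.inr_map]
    have hc : ∀ n, sumAct M.B M.action.hom n ≫ e = P.obj n ◁ tpowMap e n ≫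
        sumAct N.B N.action.hom n := Alg.Hom.comm (ReflGraph.Hom.e φ)
    have hr : ∀ n, relIncl P M.B.carrier M.X.carrier n ≫ M.action.hom ≫ f =
        P.obj n ◁ tpowMap (biprod.map f (Alg.Hom.hom g)) n ≫
          relIncl P N.B.carrier N.X.carrier n ≫ N.action.hom := by
      intro n
      have := congrArg (· ≫ biprod.fst) (hc n)
      rw [he] at this
      simpa [sumAct] using this
    let F : M.X ⟶ N.X :=
      { hom := f
        comm := fun n => by
          rw [← M.action.inl_comp, ← N.action.inl_comp, Category.assoc, Category.assoc, hr,
            ← Category.assoc, ← Category.assoc (_ ◁ _), ← whiskerLeft_comp, ← whiskerLeft_comp,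
            ← tpowMap_comp, ← tpowMap_comp, biprod.inl_map] }
    refine ⟨{ g := g, f := F, action_comm := relSchur_hom_ext fun n => ?_, d_comm := ?_ }, ?_⟩
    · rw [← Category.assoc, relIncl_map, Category.assoc]
      exact (hr n).symm
    · apply Alg.hom_ext
      have := congrArg (biprod.inl ≫ ·) ht
      rw [he] at this
      simpa using this
    · exact ReflGraph.Hom.ext (Alg.hom_ext he.symm) rfl

theorem toReflGraph_isEquivalence (hP : P.IsReduced) : (toReflGraph P).IsEquivalence where
  faithful := toReflGraph_faithful
  full := toReflGraph_full
  essSurj := ⟨fun G => ⟨G.toPXMod hP, ⟨G.toPXModIso hP⟩⟩⟩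

end PXMod

end Reduced

end OperadCrossed

end

theorem mainTheorem4 {A : Type u} [Category.{v} A] [Abelian A] [HasLimits A] [HasColimits A]
    [MonoidalCategory A] [SymmetricCategory A] [MonoidalClosed A]
    (P : OperadCrossed.SymmOperad A) (hP : P.IsReduced) :
    (OperadCrossed.PXMod.toReflGraph P).IsEquivalence ∧
    ∃ h : ∀ M : OperadCrossed.PXMod P, OperadCrossed.IsCrossed P M ↔
        OperadCrossed.IsCatOne P ((OperadCrossed.PXMod.toReflGraph P).obj M),
      ((OperadCrossed.IsCatOne P).lift
        ((OperadCrossed.IsCrossed P).ι ⋙ OperadCrossed.PXMod.toReflGraph P)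
        (fun M : OperadCrossed.XMod P => (h M.obj).1 M.property) :
          OperadCrossed.XMod P ⥤ OperadCrossed.CatOne P).IsEquivalence := by
  have hE := OperadCrossed.PXMod.toReflGraph_isEquivalence hP
  refine ⟨hE, OperadCrossed.PXMod.isCrossed_iff_isCatOne, ?_⟩
  -- Fullness and faithfulness pass to full subcategories. It remains to see that the precrossed
  -- module of a `Cat¹`-algebra is crossed, which holds because its graph is isomorphic to the given
  -- one.
  refine { essSurj := ⟨fun G => ?_⟩ }
  have φ := G.obj.toPXModIso hP
  have hM := (OperadCrossed.PXMod.isCrossed_iff_isCatOne (G.obj.toPXMod hP)).2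
    (OperadCrossed.IsCatOne.of_iso φ.symm G.property)
  exact ⟨⟨G.obj.toPXMod hP, hM⟩, ⟨(OperadCrossed.IsCatOne P).ι.preimageIso φ⟩⟩
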